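/- Let $\Bbbk$ be a field of characteristic $0$. A language $\Omega$ is a set of functional symbols $s$ with arities $\nu(s)\ge 2$; $\mathcal F_\Omega\langle X\rangle$ is the free algebra of type $\Omega$ on $X=\{x_1,x_2,\dots\}$ (its elements, the linear combinations of terms, are called polynomials of type $\Omega$), and $\mathcal F_\Omega$ is the free operad, $\mathcal F_\Omega(n)$ being the space of polylinear polynomials in $x_1,\dots,x_n$. For an operad $\mathcal P$, a $\mathcal P$-algebra is a vector space $A$ with a morphism of operads $\alpha:\mathcal P\to\mathcal E(A)$ to the endomorphism operad $\mathcal E(A)(n)=\mathrm{Hom}(A^{\otimes n},A)$. Let $\mathrm{Perm}$ be the operad with $\mathrm{Perm}(n)=\Bbbk^n$, with standard basis $e^{(n)}_1,\dots,e^{(n)}_n$, with composition $\gamma_{m_1,\dots,m_n}(e^{(n)}_k;e^{(m_1)}_{j_1},\dots,e^{(m_n)}_{j_n})=e^{(m_1+\dots+m_n)}_{m_1+\dots+m_{k-1}+j_k}$ and with $S_n$ permuting coordinates, and let $\mathrm{di}\mathcal P=\mathcal P\otimes\mathrm{Perm}$ be the Hadamard product, $\mathrm{di}\mathcal P(n)=\mathcal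 P(n)\otimes\mathrm{Perm}(n)$. Let $\pi:\mathcal F_\Omega\to\mathcal P$ and $\rho:\mathcal F_\Xi\to\mathcal R$ be quotient (surjective) morphisms of operads, and let $\omega:\mathcal F_\Omega\to\mathcal F_\Xi$ be a morphism of operads that induces a morphism $\mathcal P\to\mathcal R$, also denoted by $\omega$. A $\mathcal P$-algebra $(A,\alpha)$ is $\omega$-special if $\alpha$ is the composite of $\omega:\mathcal P\to\mathcal R$ with some $\beta:\mathcal R\to\mathcal E(A)$; similarly, a $\mathrm{di}\mathcal P$-algebra is $(\omega\otimes\mathrm{id})$-special if its structure morphism is the composite of $\omega\otimes\mathrm{id}:\mathrm{di}\mathcal P\to\mathrm{di}\mathcal R$ with some $\beta:\mathrm{di}\mathcal R\to\mathcal E(A)$. Let $\Omega^{(2)}=\{s^{\kappa}\mid s\in\Omega,\ \kappa=1,\dots,\nu(s)\}$ with $\nu(s^\kappa)=\nu(s)$, and let $\zeta_\Omega:\mathcal F_{\Omega^{(2)}}\to\mathrm{di}\mathcal F_\Omega$ be the morphism of operads with $\zeta_\Omega(s^\kappa(x_1,\dots,x_n))=s(x_1,\dots,x_n)\otimes e^{(n)}_\kappa$,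 $n=\nu(s)$. Every $\mathcal P$-algebra is an algebra of type $\Omega$ through $\pi$, and every $\mathrm{di}\mathcal P$-algebra is an algebra of type $\Omega^{(2)}$ through $(\pi\otimes\mathrm{id})\circ\zeta_\Omega$; identities are understood accordingly. Let $f\in\mathcal F_{\Omega^{(2)}}\langle X\rangle$. For a multidegree $d=(d_1,d_2,\dots)$ with $|d|=\sum_i d_i<\infty$, let $L_d(f)\in\mathcal F_{\Omega^{(2)}}(|d|)$ be the complete linearization of $f$ with respect to $d$: the part, linear in each of $|d|$ new variables, of the polynomial obtained from $f$ by substituting for each $x_i$ the sum of $d_i$ new variables (different for different $i$, numbered consecutively). (a) If $f$ is homogeneous of multidegree $d$, $L(f)=L_d(f)$ and $n=|d|$, then the following are equivalent: (S1) $f=0$ is an identity on all $(\omega\otimes\mathrm{id})$-special $\mathrm{di}\mathcal P$-algebras, but not an identity on all $\mathrm{di}\mathcal P$-algebras; (S2) $\zeta_\Omega(n)(L(f))=\sum_{k=1}^n f_k\otimes e^{(n)}_k$ with $f_k\in\mathcal F_\Omega(n)$, where all $f_k$ are identities on the class of all $\omega$-special $\mathcal P$-algebras and at least one of them is not an identity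 on the class of all $\mathcal P$-algebras. (b) For an arbitrary $f$, (S1) is equivalent to the following: for every multidegree $d$ one has $\zeta_\Omega(|d|)(L_d(f))=\sum_{k=1}^{|d|} f_{d,k}\otimes e^{(|d|)}_k$ with $f_{d,k}\in\mathcal F_\Omega(|d|)$, where all $f_{d,k}$ are identities on the class of all $\omega$-special $\mathcal P$-algebras and at least one of them is not an identity on the class of all $\mathcal P$-algebras. -/

import Mathlib

open scoped TensorProduct

universe u

namespace DiOperad

section Reindexing

/-- Relabelling of the inputs in the left unit law. -/
def unitLeftEquiv (m : ℕ) : Fin (∑ _i : Fin 1, m) ≃ Fin m :=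
  finSigmaFinEquiv.symm.trans (Equiv.uniqueSigma (fun _ : Fin 1 => Fin m))

/-- Relabelling of the inputs in the right unit law. -/
def unitRightEquiv (n : ℕ) : Fin (∑ _i : Fin n, 1) ≃ Fin n :=
  finSigmaFinEquiv.symm.trans (Equiv.sigmaUnique (Fin n) (fun _ => Fin 1))

/-- Relabelling `((i, j), r) ↦ (i, (j, r))` of the inputs of an iterated composition. -/
def assocEquiv {n : ℕ} (m : Fin n → ℕ) (l : ∀ i, Fin (m i) → ℕ) :
    Fin (∑ q : Fin (∑ i, m i), l (finSigmaFinEquiv.symm q).1 (finSigmaFinEquiv.symm q).2) ≃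
      Fin (∑ i, ∑ j, l i j) :=
  finSigmaFinEquiv.symm.trans <|
    (Equiv.sigmaCongrLeft (β := fun p : (i : Fin n) × Fin (m i) => Fin (l p.1 p.2))
      finSigmaFinEquiv.symm).trans <|
    (Equiv.sigmaAssoc (fun i j => Fin (l i j))).trans <|
    (Equiv.sigmaCongrRight fun _ => finSigmaFinEquiv).trans finSigmaFinEquiv

/-- The block permutation `(i, j) ↦ (σ i, j)`. -/
def blockLeftEquiv {n n' : ℕ} (σ : Fin n ≃ Fin n') (m : Fin n' → ℕ) :
    Fin (∑ i, m (σ i)) ≃ Fin (∑ i, m i) :=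
  finSigmaFinEquiv.symm.trans <|
    (Equiv.sigmaCongrLeft (β := fun i => Fin (m i)) σ).trans finSigmaFinEquiv

/-- The direct sum `(i, j) ↦ (i, τ i j)` of permutations. -/
def blockRightEquiv {n : ℕ} {m m' : Fin n → ℕ} (τ : ∀ i, Fin (m i) ≃ Fin (m' i)) :
    Fin (∑ i, m i) ≃ Fin (∑ i, m' i) :=
  finSigmaFinEquiv.symm.trans <| (Equiv.sigmaCongrRight τ).trans finSigmaFinEquiv

theorem assocEquiv_apply {n : ℕ} (m : Fin n → ℕ) (l : ∀ i, Fin (m i) → ℕ)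
    (q : Fin (∑ i, m i))
    (r : Fin (l (finSigmaFinEquiv.symm q).1 (finSigmaFinEquiv.symm q).2)) :
    assocEquiv m l (finSigmaFinEquiv ⟨q, r⟩) =
      finSigmaFinEquiv ⟨(finSigmaFinEquiv.symm q).1,
        finSigmaFinEquiv ⟨(finSigmaFinEquiv.symm q).2, r⟩⟩ := by
  simp [assocEquiv, Equiv.sigmaAssoc]

theorem blockLeftEquiv_apply {n n' : ℕ} (σ : Fin n ≃ Fin n') (m : Fin n' → ℕ)
    (i : Fin n) (j : Fin (m (σ i))) :
    blockLeftEquiv σ m (finSigmaFinEquiv ⟨i, j⟩) = finSigmaFinEquiv ⟨σ i, j⟩ := by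
  simp [blockLeftEquiv]

theorem blockRightEquiv_apply {n : ℕ} {m m' : Fin n → ℕ} (τ : ∀ i, Fin (m i) ≃ Fin (m' i))
    (i : Fin n) (j : Fin (m i)) :
    blockRightEquiv τ (finSigmaFinEquiv ⟨i, j⟩) = finSigmaFinEquiv ⟨i, τ i j⟩ := by
  simp [blockRightEquiv]

theorem unitLeftEquiv_apply (m : ℕ) (j : Fin m) :
    unitLeftEquiv m (finSigmaFinEquiv ⟨0, j⟩) = j := by
  simp [unitLeftEquiv, Equiv.uniqueSigma]

theorem unitRightEquiv_apply (n : ℕ) (i : Fin n) :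
    unitRightEquiv n (finSigmaFinEquiv ⟨i, 0⟩) = i := by
  simp [unitRightEquiv]

end Reindexing

/-- A symmetric `k`-linear operad: vector spaces `obj n`, an action of the symmetric groups,
an identity element `one` and composition maps `γ_{m₁, …, mₙ}`.

The action is given for bijections `Fin m ≃ Fin n`; as these exist only for `m = n`, this is the
same as an action of `Sₙ` on `obj n` for every `n`.  The inputs of a composition are numbered
lexicographically by `finSigmaFinEquiv : (i : Fin n) × Fin (m i) ≃ Fin (∑ i, m i)`. -/
structure Operad (k : Type u) [Field k] where
  obj : ℕ → Type u
  [addCommGroup : ∀ n, AddCommGroup (obj n)]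
  [module : ∀ n, Module k (obj n)]
  act : ∀ {m n : ℕ}, (Fin m ≃ Fin n) → obj m →ₗ[k] obj n
  one : obj 1
  comp : ∀ {n : ℕ} (m : Fin n → ℕ),
    obj n →ₗ[k] MultilinearMap k (fun i => obj (m i)) (obj (∑ i, m i))
  act_refl : ∀ {n : ℕ} (f : obj n), act (Equiv.refl (Fin n)) f = f
  act_trans : ∀ {l m n : ℕ} (σ : Fin l ≃ Fin m) (τ : Fin m ≃ Fin n) (f : obj l),
    act (σ.trans τ) f = act τ (act σ f)
  one_comp : ∀ {m : ℕ} (f : obj m),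
    act (unitLeftEquiv m) (comp (fun _ : Fin 1 => m) one (fun _ => f)) = f
  comp_one : ∀ {n : ℕ} (f : obj n),
    act (unitRightEquiv n) (comp (fun _ : Fin n => 1) f (fun _ => one)) = f
  comp_assoc : ∀ {n : ℕ} (m : Fin n → ℕ) (l : ∀ i, Fin (m i) → ℕ)
    (f : obj n) (g : ∀ i, obj (m i)) (h : ∀ i j, obj (l i j)),
    act (assocEquiv m l)
        (comp (fun q => l (finSigmaFinEquiv.symm q).1 (finSigmaFinEquiv.symm q).2) (comp m f g)
          (fun q => h (finSigmaFinEquiv.symm q).1 (finSigmaFinEquiv.symm q).2)) =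
      comp (fun i => ∑ j, l i j) f (fun i => comp (l i) (g i) (h i))
  act_comp : ∀ {n n' : ℕ} (σ : Fin n ≃ Fin n') (m : Fin n' → ℕ)
    (f : obj n) (g : ∀ i, obj (m i)),
    act (blockLeftEquiv σ m) (comp (fun i => m (σ i)) f (fun i => g (σ i))) =
      comp m (act σ f) g
  comp_act : ∀ {n : ℕ} {m m' : Fin n → ℕ} (τ : ∀ i, Fin (m i) ≃ Fin (m' i))
    (f : obj n) (g : ∀ i, obj (m i)),
    act (blockRightEquiv τ) (comp m f g) = comp m' f (fun i => act (τ i) (g i))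

attribute [instance] Operad.addCommGroup Operad.module

/-- A morphism of operads. -/
structure Hom {k : Type u} [Field k] (P Q : Operad.{u} k) where
  map : ∀ n, P.obj n →ₗ[k] Q.obj n
  map_act : ∀ {m n : ℕ} (σ : Fin m ≃ Fin n) (f : P.obj m), map n (P.act σ f) = Q.act σ (map m f)
  map_one : map 1 P.one = Q.one
  map_comp : ∀ {n : ℕ} (m : Fin n → ℕ) (f : P.obj n) (g : ∀ i, P.obj (m i)),
    map _ (P.comp m f g) = Q.comp m (map n f) (fun i => map (m i) (g i))

/-- The composite `ψ ∘ φ` of morphisms of operads. -/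
def Hom.comp {k : Type u} [Field k] {P Q R : Operad.{u} k} (ψ : Hom Q R) (φ : Hom P Q) :
    Hom P R where
  map n := ψ.map n ∘ₗ φ.map n
  map_act σ f := by simp [φ.map_act, ψ.map_act]
  map_one := by simp [φ.map_one, ψ.map_one]
  map_comp m f g := by simp [φ.map_comp, ψ.map_comp]

/-- A quotient morphism of operads. -/
def Hom.IsQuotient {k : Type u} [Field k] {P Q : Operad.{u} k} (φ : Hom P Q) : Prop :=
  ∀ n, Function.Surjective (φ.map n)

section EndOperad

variable (k : Type u) [Field k] (A : Type u) [AddCommGroup A] [Module k A]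

theorem compMultilinearMap_update {n : ℕ} {m : Fin n → ℕ} (f : MultilinearMap k (fun _ : Fin n => A) A)
    [DecidableEq (Fin n)]
    (g : ∀ i, MultilinearMap k (fun _ : Fin (m i) => A) A) (i : Fin n)
    (z : MultilinearMap k (fun _ : Fin (m i) => A) A) (v : (i : Fin n) × Fin (m i) → A) :
    f.compMultilinearMap (Function.update g i z) v =
      f (Function.update (fun i' => g i' fun j => v ⟨i', j⟩) i (z fun j => v ⟨i, j⟩)) := by
  refine congrArg f (funext fun i' => ?_)
  by_cases h : i' = i
  · subst h
    simp
    rfl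
  · simp [h]
    rfl

/-- The composition of multilinear maps, `v ↦ f (g₁ (block 1 of v), …, gₙ (block n of v))`. -/
def endComp {n : ℕ} (m : Fin n → ℕ) :
    MultilinearMap k (fun _ : Fin n => A) A →ₗ[k]
      MultilinearMap k (fun i => MultilinearMap k (fun _ : Fin (m i) => A) A)
        (MultilinearMap k (fun _ : Fin (∑ i, m i) => A) A) where
  toFun f :=
    { toFun := fun g => (f.compMultilinearMap g).domDomCongr finSigmaFinEquiv
      map_update_add' := by
        intro _ g i x y
        ext v
        simp only [add_apply, MultilinearMap.domDomCongr_apply,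
          compMultilinearMap_update, MultilinearMap.map_update_add]
      map_update_smul' := by
        intro _ g i c x
        ext v
        simp only [smul_apply, MultilinearMap.domDomCongr_apply,
          compMultilinearMap_update, MultilinearMap.map_update_smul] }
  map_add' f f' := by ext; simp
  map_smul' c f := by ext; simp

theorem endComp_apply {n : ℕ} (m : Fin n → ℕ) (f : MultilinearMap k (fun _ : Fin n => A) A)
    (g : ∀ i, MultilinearMap k (fun _ : Fin (m i) => A) A) (v : Fin (∑ i, m i) → A) :
    endComp k A m f g v = f fun i => g i fun j => v (finSigmaFinEquiv ⟨i, j⟩) := rfl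

/-- Permuting the arguments: `(σ f)(v₁, …, vₙ) = f (v_{σ 1}, …, v_{σ n})`. -/
def endAct {m n : ℕ} (σ : Fin m ≃ Fin n) :
    MultilinearMap k (fun _ : Fin m => A) A →ₗ[k] MultilinearMap k (fun _ : Fin n => A) A where
  toFun f := f.domDomCongr σ
  map_add' _ _ := rfl
  map_smul' _ _ := rfl

theorem endAct_apply {m n : ℕ} (σ : Fin m ≃ Fin n) (f : MultilinearMap k (fun _ : Fin m => A) A)
    (v : Fin n → A) : endAct k A σ f v = f fun i => v (σ i) := rfl

/-- The operad of endomorphisms `ℰ(A)`: `ℰ(A)(n)` is the space of `n`-linear maps from `A` to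
`A`. -/
def endOperad : Operad.{u} k where
  obj n := MultilinearMap k (fun _ : Fin n => A) A
  act := endAct k A
  one := MultilinearMap.ofSubsingleton k A A (0 : Fin 1) LinearMap.id
  comp := endComp k A
  act_refl f := rfl
  act_trans σ τ f := rfl
  one_comp {m} f := MultilinearMap.ext fun v => by
    show f (fun j => v (unitLeftEquiv m (finSigmaFinEquiv ⟨0, j⟩))) = f v
    simp only [unitLeftEquiv_apply]
  comp_one {n} f := MultilinearMap.ext fun v => by
    show f (fun i => v (unitRightEquiv n (finSigmaFinEquiv ⟨i, 0⟩))) = f v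
    simp only [unitRightEquiv_apply]
  comp_assoc m l f g h := MultilinearMap.ext fun v => by
    rw [endAct_apply, endComp_apply, endComp_apply, endComp_apply]
    refine congrArg f (funext fun i => ?_)
    rw [endComp_apply]
    refine congrArg (g i) (funext fun j => ?_)
    simp only [assocEquiv_apply]
    exact congrArg (fun p : (i : Fin _) × Fin (m i) =>
      h p.1 p.2 fun r => v (finSigmaFinEquiv ⟨p.1, finSigmaFinEquiv ⟨p.2, r⟩⟩))
      (Equiv.symm_apply_apply finSigmaFinEquiv ⟨i, j⟩)
  act_comp σ m f g := MultilinearMap.ext fun v => by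
    rw [endAct_apply, endComp_apply, endComp_apply, endAct_apply]
    simp only [blockLeftEquiv_apply]
  comp_act τ f g := MultilinearMap.ext fun v => by
    rw [endAct_apply, endComp_apply, endComp_apply]
    simp only [blockRightEquiv_apply, endAct_apply]

end EndOperad

/-- A language: a set of functional symbols with arities at least two. -/
structure Language where
  Sym : Type u
  ar : Sym → ℕ
  two_le : ∀ s, 2 ≤ ar s

/-- Terms (monomials) of type `Ω` in variables from `X`. -/
inductive Term (Ω : Language.{u}) (X : Type) : Type u
  | var (x : X) : Term Ω X
  | op (s : Ω.Sym) (a : Fin (Ω.ar s) → Term Ω X) : Term Ω X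

/-- The multidegree of a term: the number of occurrences of every variable. -/
noncomputable def Term.deg {Ω : Language.{u}} {X : Type} : Term Ω X → X →₀ ℕ
  | .var x => Finsupp.single x 1
  | .op _ a => ∑ j, (a j).deg

/-- Polynomials of type `Ω`, the elements of the free algebra `𝓕_Ω⟨X⟩`: formal linear
combinations of terms. -/
abbrev Poly (k : Type u) [Field k] (Ω : Language.{u}) (X : Type) : Type u := Term Ω X →₀ k

/-- A structure of an algebra of type `Ω` on `A`. -/
abbrev AlgStructure (k : Type u) [Field k] (Ω : Language.{u}) (A : Type u)
    [AddCommGroup A] [Module k A] : Type u :=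
  ∀ s : Ω.Sym, MultilinearMap k (fun _ : Fin (Ω.ar s) => A) A

section Evaluation

variable {k : Type u} [Field k] {Ω : Language.{u}} {X Y Z : Type} {A : Type u} [AddCommGroup A]
  [Module k A]

/-- The value of a term in an algebra of type `Ω`. -/
def Term.eval (ops : AlgStructure k Ω A) (v : X → A) : Term Ω X → A
  | .var x => v x
  | .op s a => ops s fun j => (a j).eval ops v

/-- The value of a polynomial in an algebra of type `Ω`. -/
noncomputable def Poly.eval (ops : AlgStructure k Ω A) (v : X → A) : Poly k Ω X →ₗ[k] A :=
  Finsupp.linearCombination k (Term.eval ops v)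

/-- The monomial `x`. -/
noncomputable def Poly.var (x : X) : Poly k Ω X := Finsupp.single (.var x) 1

open Classical in
/-- The free algebra structure on the space of polynomials: the multilinear extension of
`(t₁, …, tₙ) ↦ s(t₁, …, tₙ)`. -/
noncomputable def Poly.ops (k : Type u) [Field k] (Ω : Language.{u}) (X : Type) :
    AlgStructure k Ω (Poly k Ω X) :=
  fun s => (Finsupp.lmapDomain k k (Term.op s) ∘ₗ
    (PiTensorProduct.ofFinsuppEquiv' (R := k) (κ := fun _ : Fin (Ω.ar s) => Term Ω X)).toLinearMap
    ).compMultilinearMap (PiTensorProduct.tprod k)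

theorem Poly.ops_single (s : Ω.Sym) (a : Fin (Ω.ar s) → Term Ω X) (c : Fin (Ω.ar s) → k) :
    Poly.ops k Ω X s (fun j => Finsupp.single (a j) (c j)) =
      Finsupp.single (.op s a) (∏ j, c j) := by
  simp [Poly.ops]

/-- Substitution `f(g₁, g₂, …)`. -/
noncomputable def Poly.subst (g : X → Poly k Ω Y) : Poly k Ω X →ₗ[k] Poly k Ω Y :=
  Poly.eval (Poly.ops k Ω Y) g

theorem Poly.eval_single (ops : AlgStructure k Ω A) (v : X → A) (t : Term Ω X) (c : k) :
    Poly.eval ops v (Finsupp.single t c) = c • t.eval ops v := by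
  simp [Poly.eval]

theorem Poly.eval_var (ops : AlgStructure k Ω A) (v : X → A) (x : X) :
    Poly.eval ops v (Poly.var x) = v x := by
  simp [Poly.var, Poly.eval_single, Term.eval]

theorem Poly.eval_ops (ops : AlgStructure k Ω A) (v : X → A) (s : Ω.Sym)
    (p : Fin (Ω.ar s) → Poly k Ω X) :
    Poly.eval ops v (Poly.ops k Ω X s p) = ops s fun j => Poly.eval ops v (p j) := by
  have : (Poly.eval ops v).compMultilinearMap (Poly.ops k Ω X s) =
      (ops s).compLinearMap fun _ => Poly.eval ops v := by
    refine Module.Basis.ext_multilinear (fun _ => Finsupp.basisSingleOne) fun a => ?_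
    simp [Poly.ops_single, Poly.eval_single, Term.eval]
  exact DFunLike.congr_fun this p

theorem Poly.eval_term (ops : AlgStructure k Ω A) (v : Y → A) (g : X → Poly k Ω Y)
    (t : Term Ω X) :
    Poly.eval ops v (t.eval (Poly.ops k Ω Y) g) = t.eval ops fun x => Poly.eval ops v (g x) := by
  induction t with
  | var x => rfl
  | op s a ih => simp only [Term.eval, Poly.eval_ops, ih]

theorem Poly.eval_subst (ops : AlgStructure k Ω A) (v : Y → A) (g : X → Poly k Ω Y)
    (f : Poly k Ω X) :
    Poly.eval ops v (Poly.subst g f) = Poly.eval ops (fun x => Poly.eval ops v (g x)) f := by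
  induction f using Finsupp.induction_linear with
  | zero => simp
  | add f f' h h' => simp only [map_add, h, h']
  | single t c => simp only [Poly.subst, Poly.eval_single, map_smul, Poly.eval_term]

theorem Poly.subst_subst (h : Y → Poly k Ω Z) (g : X → Poly k Ω Y) (f : Poly k Ω X) :
    Poly.subst h (Poly.subst g f) = Poly.subst (fun x => Poly.subst h (g x)) f :=
  Poly.eval_subst _ _ _ _

theorem Poly.subst_var (g : X → Poly k Ω Y) (x : X) : Poly.subst g (Poly.var x) = g x :=
  Poly.eval_var _ _ _

theorem Term.eval_var (t : Term Ω X) :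
    t.eval (Poly.ops k Ω X) Poly.var = Finsupp.single t 1 := by
  induction t with
  | var x => rfl
  | op s a ih => simp [Term.eval, ih, Poly.ops_single]

theorem Poly.subst_id (f : Poly k Ω X) : Poly.subst Poly.var f = f := by
  induction f using Finsupp.induction_linear with
  | zero => simp
  | add f f' h h' => simp only [map_add, h, h']
  | single t c => simp [Poly.subst, Poly.eval_single, Term.eval_var]

theorem Term.eval_update_of_deg_eq_zero [DecidableEq X] (ops : AlgStructure k Ω A) (v : X → A)
    (x : X) (a : A) (t : Term Ω X) (ht : t.deg x = 0) :
    t.eval ops (Function.update v x a) = t.eval ops v := by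
  induction t with
  | var y =>
    have : y ≠ x := by
      rintro rfl
      simp [Term.deg] at ht
    simp [Term.eval, this]
  | op s b ih =>
    simp only [Term.deg, Finsupp.finsetSum_apply, Finset.sum_eq_zero_iff] at ht
    simp only [Term.eval]
    exact congrArg _ (funext fun j => ih j (ht j (Finset.mem_univ j)))

/-- A term is linear in every variable that occurs in it exactly once. -/
theorem Term.eval_update_of_deg_eq_one [DecidableEq X] (ops : AlgStructure k Ω A) (v : X → A)
    (x : X) (t : Term Ω X) (ht : t.deg x = 1) :
    ∃ l : A →ₗ[k] A, ∀ a, t.eval ops (Function.update v x a) = l a := by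
  induction t with
  | var y =>
    have : y = x := by
      by_contra h
      simp [Term.deg, h] at ht
    subst this
    exact ⟨LinearMap.id, fun a => by simp [Term.eval]⟩
  | op s b ih =>
    simp only [Term.deg, Finsupp.finsetSum_apply] at ht
    obtain ⟨j, hj⟩ : ∃ j, (b j).deg x ≠ 0 := by
      by_contra! h
      simp [h] at ht
    have hsum := Finset.add_sum_erase Finset.univ (fun j => (b j).deg x) (Finset.mem_univ j)
    simp only [ht] at hsum
    have hj1 : (b j).deg x = 1 := by omega
    have h0 : ∀ j', j' ≠ j → (b j').deg x = 0 := by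
      intro j' hj'
      have h : ∑ j ∈ Finset.univ.erase j, (b j).deg x = 0 := by omega
      exact Finset.sum_eq_zero_iff.mp h j' (by simp [hj'])
    obtain ⟨l, hl⟩ := ih j hj1
    refine ⟨(ops s).toLinearMap (fun j => (b j).eval ops v) j ∘ₗ l, fun a => ?_⟩
    simp only [Term.eval, LinearMap.comp_apply, MultilinearMap.toLinearMap_apply]
    refine congrArg _ (funext fun j' => ?_)
    by_cases h : j' = j
    · subst h
      simp [hl]
    · simp [h, Term.eval_update_of_deg_eq_zero ops v x a _ (h0 j' h)]

theorem Poly.eval_update_of_deg_eq_one [DecidableEq X] (ops : AlgStructure k Ω A) (v : X → A)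
    (x : X) (f : Poly k Ω X) (hf : ∀ t ∈ f.support, t.deg x = 1) :
    ∃ l : A →ₗ[k] A, ∀ a, Poly.eval ops (Function.update v x a) f = l a := by
  choose l hl using fun t : f.support => Term.eval_update_of_deg_eq_one ops v x t.1 (hf t.1 t.2)
  refine ⟨∑ t : f.support, f t.1 • l t, fun a => ?_⟩
  rw [Poly.eval, Finsupp.linearCombination_apply, Finsupp.sum, ← Finset.sum_coe_sort]
  simp [hl, LinearMap.sum_apply]

/-- Polynomials that are homogeneous of multidegree `d`. -/
def Poly.homogeneous (k : Type u) [Field k] (Ω : Language.{u}) {X : Type} (d : X →₀ ℕ) :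
    Submodule k (Poly k Ω X) :=
  Finsupp.supported k k {t | t.deg = d}

theorem Poly.ops_mem_homogeneous (s : Ω.Sym) (p : Fin (Ω.ar s) → Poly k Ω X)
    (d : Fin (Ω.ar s) → X →₀ ℕ) (hp : ∀ j, p j ∈ Poly.homogeneous k Ω (d j)) :
    Poly.ops k Ω X s p ∈ Poly.homogeneous k Ω (∑ j, d j) := by
  classical
  refine (Finsupp.mem_supported k _).mpr fun t ht => ?_
  obtain ⟨a, ha, rfl⟩ := Finset.mem_image.mp (Finsupp.mapDomain_support ht)
  simp only [Finsupp.mem_support_iff] at ha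
  have ha' : ∀ j, p j (a j) ≠ 0 := by
    intro j hj
    apply ha
    simp only [LinearEquiv.coe_coe, PiTensorProduct.ofFinsuppEquiv'_apply_apply]
    exact Finset.prod_eq_zero (Finset.mem_univ j) hj
  show ∑ j, (a j).deg = _
  refine Finset.sum_congr rfl fun j _ => ?_
  exact (Finsupp.mem_supported k _).mp (hp j) (Finsupp.mem_support_iff.mpr (ha' j))

theorem Term.eval_mem_homogeneous (g : X → Poly k Ω Y) (e : X → Y →₀ ℕ)
    (hg : ∀ x, g x ∈ Poly.homogeneous k Ω (e x)) (t : Term Ω X) :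
    t.eval (Poly.ops k Ω Y) g ∈ Poly.homogeneous k Ω (t.deg.sum fun x n => n • e x) := by
  induction t with
  | var x => simpa [Term.eval, Term.deg] using hg x
  | op s a ih =>
    have h : (Term.op s a).deg.sum (fun x n => n • e x) =
        ∑ j, (a j).deg.sum fun x n => n • e x :=
      (Finsupp.sum_finsetSum_index (M := ℕ) (N := Y →₀ ℕ) (h := fun x n => n • e x)
        (fun x => zero_smul ℕ (e x))
        (fun x m n => add_smul m n (e x))).symm
    rw [h]
    exact Poly.ops_mem_homogeneous s _ _ ih

theorem Poly.subst_mem_homogeneous (g : X → Poly k Ω Y) (e : X → Y →₀ ℕ)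
    (hg : ∀ x, g x ∈ Poly.homogeneous k Ω (e x)) (d : X →₀ ℕ) (f : Poly k Ω X)
    (hf : f ∈ Poly.homogeneous k Ω d) :
    Poly.subst g f ∈ Poly.homogeneous k Ω (d.sum fun x n => n • e x) := by
  refine Submodule.sum_mem _ fun t ht => ?_
  have hd : t.deg = d := (Finsupp.mem_supported k _).mp hf ht
  subst hd
  exact Submodule.smul_mem _ _ (Term.eval_mem_homogeneous g e hg t)

end Evaluation

section FreeOperad

variable (k : Type u) [Field k] (Ω : Language.{u})

/-- The multidegree `(1, …, 1)`. -/
noncomputable def ones (n : ℕ) : Fin n →₀ ℕ := Finsupp.equivFunOnFinite.symm 1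

/-- `𝓕_Ω(n)`: polylinear polynomials of degree `n` in `x₁, …, xₙ`, i.e. linear combinations of
terms in which each of the `n` variables occurs exactly once. -/
noncomputable abbrev polylinear (n : ℕ) : Submodule k (Poly k Ω (Fin n)) := Poly.homogeneous k Ω (ones n)

variable {k Ω}

theorem mem_polylinear_deg {n : ℕ} {f : Poly k Ω (Fin n)} (hf : f ∈ polylinear k Ω n)
    {t : Term Ω (Fin n)} (ht : t ∈ f.support) (i : Fin n) : t.deg i = 1 := by
  have h : t.deg = ones n := (Finsupp.mem_supported k _).mp hf ht
  rw [h]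
  rfl

theorem ones_sum {n : ℕ} {Y : Type} (e : Fin n → Y →₀ ℕ) :
    ((ones n).sum fun i m => m • e i) = ∑ i, e i := by
  rw [Finsupp.sum_fintype _ _ (by simp)]
  simp [ones]

theorem subst_mem_polylinear {m n : ℕ} (e : Fin m → Fin n →₀ ℕ) (he : ∑ i, e i = ones n)
    (g : Fin m → Poly k Ω (Fin n)) (hg : ∀ i, g i ∈ Poly.homogeneous k Ω (e i))
    (f : Poly k Ω (Fin m)) (hf : f ∈ polylinear k Ω m) :
    Poly.subst g f ∈ polylinear k Ω n := by
  have := Poly.subst_mem_homogeneous g e hg _ f hf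
  rwa [ones_sum, he] at this

theorem var_mem_homogeneous {Y : Type} (y : Y) :
    (Poly.var y : Poly k Ω Y) ∈ Poly.homogeneous k Ω (Finsupp.single y 1) :=
  Finsupp.single_mem_supported k _ rfl

/-- The polynomial `g(x_{(i,1)}, …, x_{(i,mᵢ)})` in the variables of the `i`-th block. -/
noncomputable def toBlock {n : ℕ} (m : Fin n → ℕ) (i : Fin n) :
    Poly k Ω (Fin (m i)) →ₗ[k] Poly k Ω (Fin (∑ i, m i)) :=
  Poly.subst fun j => Poly.var (finSigmaFinEquiv ⟨i, j⟩)

theorem toBlock_mem {n : ℕ} (m : Fin n → ℕ) (i : Fin n) (g : Poly k Ω (Fin (m i)))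
    (hg : g ∈ polylinear k Ω (m i)) :
    toBlock m i g ∈ Poly.homogeneous k Ω
      (∑ j, Finsupp.single (finSigmaFinEquiv (⟨i, j⟩ : (i : Fin n) × Fin (m i))) 1) := by
  have := Poly.subst_mem_homogeneous
    (fun j => (Poly.var (finSigmaFinEquiv (⟨i, j⟩ : (i : Fin n) × Fin (m i))) : Poly k Ω _))
    _ (fun j => var_mem_homogeneous _) _ g hg
  rwa [ones_sum] at this

theorem sum_blocks {n : ℕ} (m : Fin n → ℕ) :
    ∑ i, ∑ j, Finsupp.single (finSigmaFinEquiv (⟨i, j⟩ : (i : Fin n) × Fin (m i))) 1 =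
      ones (∑ i, m i) := by
  rw [← Fintype.sum_sigma',
    Equiv.sum_comp finSigmaFinEquiv (fun q : Fin (∑ i, m i) => Finsupp.single q 1)]
  ext q
  simp [ones, Finsupp.finsetSum_apply, Finsupp.single_apply]

theorem exists_subst_toBlock_update {n : ℕ} [DecidableEq (Fin n)] (m : Fin n → ℕ)
    (f : Poly k Ω (Fin n))
    (hf : f ∈ polylinear k Ω n) (g : ∀ i, polylinear k Ω (m i)) (i : Fin n) :
    ∃ l : Poly k Ω (Fin (m i)) →ₗ[k] Poly k Ω (Fin (∑ i, m i)), ∀ z : polylinear k Ω (m i),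
      Poly.subst (fun i' => toBlock m i' (Function.update g i z i')) f = l z := by
  obtain ⟨l, hl⟩ := Poly.eval_update_of_deg_eq_one (Poly.ops k Ω (Fin (∑ i, m i)))
    (fun i' => toBlock m i' (g i')) i f fun t ht => mem_polylinear_deg hf ht i
  refine ⟨l ∘ₗ toBlock m i, fun z => ?_⟩
  rw [LinearMap.comp_apply, ← hl, Poly.subst]
  congr 2
  ext1 i'
  by_cases h : i' = i
  · subst h; simp
  · simp [h]

theorem subst_toBlock_mem {n : ℕ} (m : Fin n → ℕ) (f : polylinear k Ω n)
    (g : ∀ i, polylinear k Ω (m i)) :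
    Poly.subst (fun i => toBlock m i (g i : Poly k Ω (Fin (m i)))) (f : Poly k Ω (Fin n)) ∈
      polylinear k Ω (∑ i, m i) := by
  have h1 := fun i => toBlock_mem m i (g i : Poly k Ω (Fin (m i))) (g i).2
  have h2 := sum_blocks m
  have h3 := subst_mem_polylinear _ h2 (fun i => toBlock m i (g i : Poly k Ω (Fin (m i))))
  have h4 := h3 h1
  exact h4 (f : Poly k Ω (Fin n)) f.2

/-- The composition in the free operad, for a fixed outer polynomial `f`. -/
noncomputable def freeCompAux {n : ℕ} (m : Fin n → ℕ) (f : polylinear k Ω n) :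
    MultilinearMap k (fun i => polylinear k Ω (m i)) (polylinear k Ω (∑ i, m i)) where
  toFun g := ⟨Poly.subst (fun i => toBlock m i (g i : Poly k Ω (Fin (m i)))) (f : Poly k Ω (Fin n)),
    subst_toBlock_mem m f g⟩
  map_update_add' g i x y := by
    obtain ⟨l, hl⟩ := exists_subst_toBlock_update m f.1 f.2 g i
    refine Subtype.ext ?_
    simp only [Submodule.coe_add, hl, map_add]
  map_update_smul' g i c x := by
    obtain ⟨l, hl⟩ := exists_subst_toBlock_update m f.1 f.2 g i
    refine Subtype.ext ?_
    simp only [Submodule.coe_smul, hl, map_smul]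

/-- The composition in the free operad:
`γ(f; g₁, …, gₙ) = f(g₁(x₁, …, x_{m₁}), g₂(x_{m₁+1}, …, x_{m₁+m₂}), …)`. -/
noncomputable def freeComp {n : ℕ} (m : Fin n → ℕ) :
    polylinear k Ω n →ₗ[k]
      MultilinearMap k (fun i => polylinear k Ω (m i)) (polylinear k Ω (∑ i, m i)) where
  toFun := freeCompAux m
  map_add' f f' := MultilinearMap.ext fun _ => Subtype.ext (map_add _ f.1 f'.1)
  map_smul' c f := MultilinearMap.ext fun _ => Subtype.ext (map_smul _ c f.1)

theorem freeComp_coe {n : ℕ} (m : Fin n → ℕ) (f : polylinear k Ω n)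
    (g : ∀ i, polylinear k Ω (m i)) :
    (freeComp m f g : Poly k Ω (Fin (∑ i, m i))) =
      Poly.subst (fun i => toBlock m i (g i)) (f : Poly k Ω (Fin n)) := rfl

/-- The action of permutations by renaming the variables. -/
noncomputable def freeAct {m n : ℕ} (σ : Fin m ≃ Fin n) :
    polylinear k Ω m →ₗ[k] polylinear k Ω n :=
  (Poly.subst fun i => Poly.var (σ i)).restrict fun f hf =>
    subst_mem_polylinear _ (by
      rw [Equiv.sum_comp σ (fun q : Fin n => Finsupp.single q 1)]
      ext q
      simp [ones, Finsupp.finsetSum_apply, Finsupp.single_apply])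
      _ (fun _ => var_mem_homogeneous _) f hf

theorem freeAct_coe {m n : ℕ} (σ : Fin m ≃ Fin n) (f : polylinear k Ω m) :
    (freeAct σ f : Poly k Ω (Fin n)) =
      Poly.subst (fun i => Poly.var (σ i)) (f : Poly k Ω (Fin m)) := rfl

theorem freeAct_freeComp {n n' : ℕ} (σ : Fin n ≃ Fin n') (m : Fin n' → ℕ)
    (f : polylinear k Ω n) (g : ∀ i, polylinear k Ω (m i)) :
    freeAct (blockLeftEquiv σ m) (freeComp (fun i => m (σ i)) f (fun i => g (σ i))) =
      freeComp m (freeAct σ f) g := by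
  refine Subtype.ext ?_
  rw [freeAct_coe, freeComp_coe, freeComp_coe, freeAct_coe]
  simp only [toBlock, Poly.subst_subst, Poly.subst_var, blockLeftEquiv_apply]

theorem freeComp_freeAct {n : ℕ} {m m' : Fin n → ℕ} (τ : ∀ i, Fin (m i) ≃ Fin (m' i))
    (f : polylinear k Ω n) (g : ∀ i, polylinear k Ω (m i)) :
    freeAct (blockRightEquiv τ) (freeComp m f g) =
      freeComp m' f (fun i => freeAct (τ i) (g i)) := by
  refine Subtype.ext ?_
  rw [freeAct_coe, freeComp_coe, freeComp_coe]
  simp only [freeAct_coe, toBlock, Poly.subst_subst, Poly.subst_var, blockRightEquiv_apply]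

theorem var_mem_polylinear : (Poly.var 0 : Poly k Ω (Fin 1)) ∈ polylinear k Ω 1 := by
  have : ones 1 = Finsupp.single 0 1 := by
    refine Finsupp.ext fun i => ?_
    rw [Subsingleton.elim i 0]
    simp [ones]
  rw [polylinear, this]
  exact var_mem_homogeneous _

theorem freeAct_refl {n : ℕ} (f : polylinear k Ω n) : freeAct (Equiv.refl (Fin n)) f = f :=
  Subtype.ext (Poly.subst_id _)

theorem freeAct_trans {l m n : ℕ} (σ : Fin l ≃ Fin m) (τ : Fin m ≃ Fin n)
    (f : polylinear k Ω l) : freeAct (σ.trans τ) f = freeAct τ (freeAct σ f) := by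
  refine Subtype.ext ?_
  simp only [freeAct_coe, Poly.subst_subst, Poly.subst_var, Equiv.trans_apply]

theorem freeComp_var_left {m : ℕ} (f : polylinear k Ω m) :
    freeAct (unitLeftEquiv m)
      (freeComp (fun _ : Fin 1 => m) ⟨Poly.var 0, var_mem_polylinear⟩ (fun _ => f)) = f := by
  refine Subtype.ext ?_
  simp only [freeAct_coe, freeComp_coe, toBlock, Poly.subst_subst, Poly.subst_var,
    unitLeftEquiv_apply, Poly.subst_id]

theorem freeComp_var_right {n : ℕ} (f : polylinear k Ω n) :
    freeAct (unitRightEquiv n)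
      (freeComp (fun _ : Fin n => 1) f (fun _ => ⟨Poly.var 0, var_mem_polylinear⟩)) = f := by
  refine Subtype.ext ?_
  simp only [freeAct_coe, freeComp_coe, toBlock, Poly.subst_subst, Poly.subst_var,
    unitRightEquiv_apply, Poly.subst_id]

theorem freeComp_assoc {n : ℕ} (m : Fin n → ℕ) (l : ∀ i, Fin (m i) → ℕ)
    (f : polylinear k Ω n) (g : ∀ i, polylinear k Ω (m i)) (h : ∀ i j, polylinear k Ω (l i j)) :
    freeAct (assocEquiv m l)
        (freeComp (fun q => l (finSigmaFinEquiv.symm q).1 (finSigmaFinEquiv.symm q).2)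
          (freeComp m f g)
          (fun q => h (finSigmaFinEquiv.symm q).1 (finSigmaFinEquiv.symm q).2)) =
      freeComp (fun i => ∑ j, l i j) f (fun i => freeComp (l i) (g i) (h i)) := by
  refine Subtype.ext ?_
  simp only [freeAct_coe, freeComp_coe, toBlock, Poly.subst_subst, Poly.subst_var,
    assocEquiv_apply]
  congr 2
  ext1 i
  congr 2
  ext1 j
  have key : ∀ p p' : (i : Fin n) × Fin (m i), p = p' →
      Poly.subst (fun r => (Poly.var (finSigmaFinEquiv
          (⟨p.1, finSigmaFinEquiv ⟨p.2, r⟩⟩ : (i : Fin n) × Fin (∑ j, l i j))) :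
          Poly k Ω (Fin (∑ i, ∑ j, l i j)))) (h p.1 p.2 : Poly k Ω (Fin (l p.1 p.2))) =
        Poly.subst (fun r => Poly.var (finSigmaFinEquiv
          (⟨p'.1, finSigmaFinEquiv ⟨p'.2, r⟩⟩ : (i : Fin n) × Fin (∑ j, l i j))))
          (h p'.1 p'.2 : Poly k Ω (Fin (l p'.1 p'.2))) := by
    rintro p _ rfl
    rfl
  exact key _ ⟨i, j⟩ (Equiv.symm_apply_apply finSigmaFinEquiv ⟨i, j⟩)

variable (k Ω)

/-- The free operad `𝓕_Ω`. -/
noncomputable def freeOperad : Operad.{u} k where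
  obj n := polylinear k Ω n
  act := freeAct
  one := ⟨Poly.var 0, var_mem_polylinear⟩
  comp := freeComp
  act_refl := freeAct_refl
  act_trans := freeAct_trans
  one_comp := freeComp_var_left
  comp_one := freeComp_var_right
  comp_assoc m l f g h := freeComp_assoc m l f g h
  act_comp σ m f g := freeAct_freeComp σ m f g
  comp_act τ f g := freeComp_freeAct τ f g

end FreeOperad

section PermOperad

/-- The coordinate that a family `x ∈ V i ^ (Fin (m i))` contributes for the index `p = (i₀, j₀)`:
`x j₀` if `i = i₀`, and the sum of all coordinates otherwise. -/
noncomputable def select (k : Type u) [Field k] {I : Type} {m : I → ℕ} (V : I → Type u)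
    [∀ i, AddCommGroup (V i)] [∀ i, Module k (V i)] (p : (i : I) × Fin (m i)) (i : I) :
    (Fin (m i) → V i) →ₗ[k] V i :=
  open Classical in
  ∑ j with (i = p.1 → (⟨i, j⟩ : (i : I) × Fin (m i)) = p), LinearMap.proj j

variable {k : Type u} [Field k]

section
variable {I : Type} {m : I → ℕ} {V : I → Type u}
    [∀ i, AddCommGroup (V i)] [∀ i, Module k (V i)]

theorem select_self (i : I) (j : Fin (m i)) (x : Fin (m i) → V i) :
    select k V ⟨i, j⟩ i x = x j := by
  classical
  have : (Finset.univ.filter fun j' : Fin (m i) =>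
      True → (⟨i, j'⟩ : (i : I) × Fin (m i)) = ⟨i, j⟩) = {j} := by
    ext j'
    simp
  simp only [select, LinearMap.sum_apply, LinearMap.proj_apply]
  rw [this, Finset.sum_singleton]

theorem select_of_ne (p : (i : I) × Fin (m i)) {i : I} (h : i ≠ p.1) (x : Fin (m i) → V i) :
    select k V p i x = ∑ j, x j := by
  classical
  simp [select, LinearMap.sum_apply, h]

theorem select_eq_update [DecidableEq I] (i : I) (j : Fin (m i)) (x : ∀ i, Fin (m i) → V i) :
    (fun i' => select k V ⟨i, j⟩ i' (x i')) =
      Function.update (fun i' => ∑ j, x i' j) i (x i j) := by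
  ext i'
  by_cases h : i' = i
  · subst h
    simp [select_self]
  · rw [select_of_ne _ h]
    simp [h]
end

variable (P : Operad.{u} k)

/-- The composition of the operad `P ⊗ Perm` in coordinates. -/
noncomputable def piComp {n : ℕ} (m : Fin n → ℕ) :
    (Fin n → P.obj n) →ₗ[k]
      MultilinearMap k (fun i => Fin (m i) → P.obj (m i))
        (Fin (∑ i, m i) → P.obj (∑ i, m i)) where
  toFun x := MultilinearMap.pi fun q =>
    (P.comp m (x (finSigmaFinEquiv.symm q).1)).compLinearMap fun i =>
      select k (fun i => P.obj (m i)) (finSigmaFinEquiv.symm q) i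
  map_add' x x' := by ext; simp
  map_smul' c x := by ext; simp

theorem piComp_apply {n : ℕ} (m : Fin n → ℕ) (x : Fin n → P.obj n)
    (y : ∀ i, Fin (m i) → P.obj (m i)) (i : Fin n) (j : Fin (m i)) :
    piComp P m x y (finSigmaFinEquiv ⟨i, j⟩) =
      P.comp m (x i) (Function.update (fun i' => ∑ j, y i' j) i (y i j)) := by
  have key : ∀ p p' : (i : Fin n) × Fin (m i), p = p' →
      P.comp m (x p.1) (fun i => select k (fun i => P.obj (m i)) p i (y i)) =
        P.comp m (x p'.1) (fun i => select k (fun i => P.obj (m i)) p' i (y i)) := by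
    rintro p _ rfl
    rfl
  rw [← select_eq_update (k := k)]
  exact key _ ⟨i, j⟩ (Equiv.symm_apply_apply _ _)

theorem sum_piComp {n : ℕ} (m : Fin n → ℕ) (x : Fin n → P.obj n)
    (y : ∀ i, Fin (m i) → P.obj (m i)) :
    ∑ q, piComp P m x y q = P.comp m (∑ i, x i) (fun i => ∑ j, y i j) := by
  rw [← Equiv.sum_comp finSigmaFinEquiv, Fintype.sum_sigma]
  simp only [piComp_apply, map_sum, sum_apply]
  refine Finset.sum_congr rfl fun i _ => ?_
  rw [← MultilinearMap.map_update_sum, Function.update_eq_self_iff.mpr rfl]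

theorem ext_block {n : ℕ} {m : Fin n → ℕ} {V : Type u} {x y : Fin (∑ i, m i) → V}
    (h : ∀ i j, x (finSigmaFinEquiv ⟨i, j⟩) = y (finSigmaFinEquiv ⟨i, j⟩)) : x = y := by
  ext q
  obtain ⟨⟨i, j⟩, rfl⟩ := finSigmaFinEquiv.surjective q
  exact h i j

/-- The action of permutations on `P ⊗ Perm` in coordinates. -/
def piAct {m n : ℕ} (σ : Fin m ≃ Fin n) : (Fin m → P.obj m) →ₗ[k] (Fin n → P.obj n) :=
  LinearMap.pi fun j => P.act σ ∘ₗ LinearMap.proj (σ.symm j)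

theorem piAct_apply {m n : ℕ} (σ : Fin m ≃ Fin n) (x : Fin m → P.obj m) (i : Fin m) :
    piAct P σ x (σ i) = P.act σ (x i) := by
  simp [piAct]

theorem piAct_ext {m n : ℕ} (σ : Fin m ≃ Fin n) (x : Fin m → P.obj m) (y : Fin n → P.obj n)
    (h : ∀ i, P.act σ (x i) = y (σ i)) : piAct P σ x = y := by
  ext j
  obtain ⟨i, rfl⟩ := σ.surjective j
  rw [piAct_apply, h]

theorem piComp_assoc_aux {n : ℕ} (m : Fin n → ℕ) (l : ∀ i, Fin (m i) → ℕ)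
    (f : Fin n → P.obj n) (g : ∀ i, Fin (m i) → P.obj (m i))
    (h : ∀ i j, Fin (l i j) → P.obj (l i j)) (p : (i : Fin n) × Fin (m i))
    (r : Fin (l p.1 p.2)) :
    P.comp (fun i => ∑ j, l i j) (f p.1) (fun i => P.comp (l i)
        (Function.update (fun i => ∑ j, g i j) p.1 (g p.1 p.2) i)
        (fun j => Function.update (fun p' : (i : Fin n) × Fin (m i) => ∑ r', h p'.1 p'.2 r') p
          (h p.1 p.2 r) ⟨i, j⟩)) =
      P.comp (fun i => ∑ j, l i j) (f p.1)
        (Function.update (fun i => ∑ q, piComp P (l i) (g i) (h i) q) p.1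
          (piComp P (l p.1) (g p.1) (h p.1) (finSigmaFinEquiv ⟨p.2, r⟩))) := by
  refine congrArg _ (funext fun i => ?_)
  by_cases hi : i = p.1
  · subst hi
    rw [Function.update_self, Function.update_self, piComp_apply]
    refine congrArg _ (funext fun j => ?_)
    by_cases hj : j = p.2
    · subst hj
      simp
    · have : (⟨p.1, j⟩ : (i : Fin n) × Fin (m i)) ≠ p := by
        intro h'
        apply hj
        rw [Sigma.ext_iff] at h'
        exact eq_of_heq h'.2
      simp [hj, this]
  · rw [Function.update_of_ne hi, Function.update_of_ne hi, sum_piComp]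
    refine congrArg _ (funext fun j => ?_)
    have : (⟨i, j⟩ : (i : Fin n) × Fin (m i)) ≠ p := by
      intro h'
      exact hi (congrArg Sigma.fst h')
    simp [this]

theorem piComp_assoc {n : ℕ} (m : Fin n → ℕ) (l : ∀ i, Fin (m i) → ℕ)
    (f : Fin n → P.obj n) (g : ∀ i, Fin (m i) → P.obj (m i))
    (h : ∀ i j, Fin (l i j) → P.obj (l i j)) :
    piAct P (assocEquiv m l)
        (piComp P (fun q => l (finSigmaFinEquiv.symm q).1 (finSigmaFinEquiv.symm q).2)
          (piComp P m f g)
          (fun q => h (finSigmaFinEquiv.symm q).1 (finSigmaFinEquiv.symm q).2)) =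
      piComp P (fun i => ∑ j, l i j) f (fun i => piComp P (l i) (g i) (h i)) := by
  refine piAct_ext _ _ _ _ fun t => ?_
  obtain ⟨⟨q, r⟩, rfl⟩ := finSigmaFinEquiv.surjective t
  rw [piComp_apply, assocEquiv_apply, piComp_apply]
  have hq := piComp_apply P m f g (finSigmaFinEquiv.symm q).1 (finSigmaFinEquiv.symm q).2
  rw [Sigma.eta, Equiv.apply_symm_apply] at hq
  have hH : Function.update
      (fun q' => ∑ r', h (finSigmaFinEquiv.symm q').1 (finSigmaFinEquiv.symm q').2 r') q
      (h (finSigmaFinEquiv.symm q).1 (finSigmaFinEquiv.symm q).2 r) =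
      fun q' => Function.update (fun p' : (i : Fin n) × Fin (m i) => ∑ r', h p'.1 p'.2 r')
        (finSigmaFinEquiv.symm q) (h (finSigmaFinEquiv.symm q).1 (finSigmaFinEquiv.symm q).2 r)
        (finSigmaFinEquiv.symm q') := by
    ext q'
    by_cases hqq : q' = q
    · subst hqq
      rw [Function.update_self, Function.update_self]
    · have : finSigmaFinEquiv.symm q' ≠ finSigmaFinEquiv.symm q :=
        fun h' => hqq (finSigmaFinEquiv.symm.injective h')
      rw [Function.update_of_ne hqq, Function.update_of_ne this]
  refine Eq.trans ?_ ((P.comp_assoc m l _ _ (fun i j =>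
    Function.update (fun p' : (i : Fin n) × Fin (m i) => ∑ r', h p'.1 p'.2 r')
      (finSigmaFinEquiv.symm q) (h (finSigmaFinEquiv.symm q).1 (finSigmaFinEquiv.symm q).2 r)
      ⟨i, j⟩)).trans (piComp_assoc_aux P m l f g h (finSigmaFinEquiv.symm q) r))
  rw [hq]
  exact congrArg (fun z => P.act (assocEquiv m l) (P.comp _ _ z)) hH

/-- The operad `P ⊗ Perm` in coordinates: a family `(f₁, …, fₙ)` stands for `∑ f_k ⊗ e_k`. -/
noncomputable def piOperad : Operad.{u} k where
  obj n := Fin n → P.obj n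
  act := piAct P
  one := fun _ => P.one
  comp := piComp P
  act_refl f := funext fun i => P.act_refl _
  act_trans σ τ f := funext fun i => P.act_trans _ _ _
  one_comp {m} f := piAct_ext _ _ _ _ fun t => by
    obtain ⟨⟨i, j⟩, rfl⟩ := finSigmaFinEquiv.surjective t
    obtain rfl : i = 0 := Subsingleton.elim _ _
    rw [piComp_apply, unitLeftEquiv_apply]
    refine Eq.trans ?_ (P.one_comp (f j))
    refine congrArg (fun z => P.act _ (P.comp _ _ z)) (funext fun i => ?_)
    obtain rfl : i = 0 := Subsingleton.elim _ _
    simp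
  comp_one {n} f := piAct_ext _ _ _ _ fun t => by
    obtain ⟨⟨i, j⟩, rfl⟩ := finSigmaFinEquiv.surjective t
    obtain rfl : j = 0 := Subsingleton.elim _ _
    rw [piComp_apply, unitRightEquiv_apply]
    refine Eq.trans ?_ (P.comp_one (f i))
    refine congrArg (fun z => P.act _ (P.comp _ _ z)) (funext fun i' => ?_)
    by_cases h : i' = i
    · subst h
      simp
    · simp [h]
  comp_assoc m l f g h := piComp_assoc P m l f g h
  act_comp σ m f g := piAct_ext _ _ _ _ fun t => by
    obtain ⟨⟨i, j⟩, rfl⟩ := finSigmaFinEquiv.surjective t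
    rw [piComp_apply, blockLeftEquiv_apply, piComp_apply, piAct_apply, ← P.act_comp]
    refine congrArg (fun z => P.act _ (P.comp _ _ z)) (funext fun i' => ?_)
    by_cases h : i' = i
    · subst h
      simp
    · simp [h]
  comp_act {n m m'} τ f g := piAct_ext _ _ _ _ fun t => by
    obtain ⟨⟨i, j⟩, rfl⟩ := finSigmaFinEquiv.surjective t
    rw [piComp_apply, blockRightEquiv_apply, piComp_apply, P.comp_act]
    refine congrArg (fun z => P.comp _ _ z) (funext fun i' => ?_)
    by_cases h : i' = i
    · subst h
      simp [piAct_apply]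
    · simp only [Function.update_of_ne h, map_sum]
      rw [← Equiv.sum_comp (τ i')]
      simp [piAct_apply]

end PermOperad

section PermOperad2

variable (k : Type u) [Field k]

/-- The operad of commutative associative algebras, `Com(n) = k`. -/
noncomputable def comOperad : Operad.{u} k where
  obj _ := k
  act _ := LinearMap.id
  one := (1 : k)
  comp {n} _ := LinearMap.toSpanSingleton k _ (MultilinearMap.mkPiAlgebra k (Fin n) k)
  act_refl _ := rfl
  act_trans _ _ _ := rfl
  one_comp f := by simp
  comp_one f := by simp
  comp_assoc m l f g h := by
    simp only [LinearMap.toSpanSingleton_apply, smul_apply,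
      MultilinearMap.mkPiAlgebra_apply, smul_eq_mul, LinearMap.id_apply, Finset.prod_mul_distrib,
      mul_assoc]
    rw [Equiv.prod_comp finSigmaFinEquiv.symm (fun p : (i : Fin _) × Fin (m i) => h p.1 p.2),
      Fintype.prod_sigma]
  act_comp σ m f g := by
    simp only [LinearMap.toSpanSingleton_apply, smul_apply,
      MultilinearMap.mkPiAlgebra_apply, smul_eq_mul, LinearMap.id_apply]
    rw [Equiv.prod_comp σ g]
  comp_act τ f g := rfl

/-- The operad `Perm`, `Perm(n) = kⁿ`. -/
noncomputable def permOperad : Operad.{u} k := piOperad (comOperad k)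

variable {k}

/-- The standard basis `e_1, …, e_n` of `Perm(n)`. -/
noncomputable def permBasis {n : ℕ} (i : Fin n) : (permOperad k).obj n :=
  (Pi.single i 1 : Fin n → k)

/-- The `i`-th coordinate of an element of `Perm(n) = kⁿ`. -/
def permCoord {n : ℕ} (a : (permOperad k).obj n) (i : Fin n) : k :=
  (show Fin n → k from a) i

theorem perm_comp_apply {n : ℕ} (m : Fin n → ℕ) (a : (permOperad k).obj n)
    (b : ∀ i, (permOperad k).obj (m i)) (i : Fin n) (j : Fin (m i)) :
    permCoord ((permOperad k).comp m a b) (finSigmaFinEquiv ⟨i, j⟩) =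
      permCoord a i *
        ∏ i', Function.update (fun i' => ∑ j, permCoord (b i') j) i (permCoord (b i) j) i' :=
  piComp_apply (comOperad k) m a b i j

theorem permCoord_basis {n : ℕ} (i j : Fin n) :
    permCoord (permBasis i : (permOperad k).obj n) j = if j = i then 1 else 0 :=
  Pi.single_apply _ _ _

theorem perm_ext {n : ℕ} {a b : (permOperad k).obj n} (h : ∀ i, permCoord a i = permCoord b i) :
    a = b := funext h

/-- `γ(e_i; e_{j₁}, …, e_{jₙ}) = e_{m₁ + … + m_{i-1} + j_i}`. -/
theorem perm_comp_basis {n : ℕ} (m : Fin n → ℕ) (i : Fin n) (j : ∀ i, Fin (m i)) :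
    (permOperad k).comp m (permBasis i) (fun i => permBasis (j i)) =
      permBasis (finSigmaFinEquiv ⟨i, j i⟩) := by
  refine perm_ext fun q => ?_
  obtain ⟨⟨i', j'⟩, rfl⟩ := finSigmaFinEquiv.surjective q
  simp only [perm_comp_apply, permCoord_basis, EmbeddingLike.apply_eq_iff_eq]
  by_cases h : i' = i
  · subst h
    by_cases h' : j' = j i'
    · subst h'
      rw [if_pos rfl, if_pos rfl, if_pos rfl, one_mul]
      refine Finset.prod_eq_one fun i _ => ?_
      by_cases hi : i = i'
      · subst hi; simp
      · simp [hi]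
    · rw [if_pos rfl, if_neg h', one_mul, if_neg (by simpa using h'),
        Finset.prod_eq_zero (Finset.mem_univ i') (by simp)]
  · rw [if_neg h, zero_mul, if_neg]
    exact fun h2 => h (congrArg Sigma.fst h2)

theorem perm_act_basis {m n : ℕ} (σ : Fin m ≃ Fin n) (i : Fin m) :
    (permOperad k).act σ (permBasis i) = permBasis (σ i) := by
  refine piAct_ext (comOperad k) σ _ _ fun i' => ?_
  show (Pi.single i 1 : Fin m → k) i' = (Pi.single (σ i) 1 : Fin n → k) (σ i')
  simp [Pi.single_apply]

/-- Transport of the structure of an operad along linear isomorphisms. -/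
noncomputable def Operad.transport (Q : Operad.{u} k) (V : ℕ → Type u)
    [∀ n, AddCommGroup (V n)] [∀ n, Module k (V n)] (e : ∀ n, V n ≃ₗ[k] Q.obj n) :
    Operad.{u} k where
  obj := V
  act {m n} σ := (e n).symm.toLinearMap ∘ₗ Q.act σ ∘ₗ (e m).toLinearMap
  one := (e 1).symm Q.one
  comp {n} m :=
    { toFun x := ((e _).symm.toLinearMap.compMultilinearMap (Q.comp m (e n x))).compLinearMap
        fun i => (e (m i)).toLinearMap
      map_add' x y := by ext; simp
      map_smul' c x := by ext; simp }
  act_refl f := by simp [Q.act_refl]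
  act_trans σ τ f := by simp [Q.act_trans]
  one_comp f := by simp [Q.one_comp]
  comp_one f := by simp [Q.comp_one]
  comp_assoc m l f g h := by
    simp [← Q.comp_assoc m l (e _ f) (fun i => e _ (g i)) (fun i j => e _ (h i j))]
  act_comp σ m f g := by
    simp [← Q.act_comp]
  comp_act τ f g := by simp [Q.comp_act]

/-- `P(n) ⊗ Perm(n)` in coordinates: `∑ f_k ⊗ e_k ↦ (f_1, …, f_n)`. -/
noncomputable def diEquiv (P : Operad.{u} k) (n : ℕ) :
    P.obj n ⊗[k] (permOperad k).obj n ≃ₗ[k] (piOperad P).obj n :=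
  TensorProduct.piScalarRight k k (P.obj n) (Fin n)

/-- The operad `diP = P ⊗ Perm`, the Hadamard product of `P` and `Perm`:
`diP(n) = P(n) ⊗ Perm(n)`, with componentwise compositions and `Sₙ`-actions (see `di_comp_tmul`,
`di_act_tmul` and `di_one`). -/
noncomputable def diOperad (P : Operad.{u} k) : Operad.{u} k :=
  (piOperad P).transport (fun n => P.obj n ⊗[k] (permOperad k).obj n) (diEquiv P)

/-- The element `f ⊗ a` of `diP(n) = P(n) ⊗ Perm(n)`. -/
noncomputable def diTmul (P : Operad.{u} k) {n : ℕ} (f : P.obj n) (a : (permOperad k).obj n) :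
    (diOperad P).obj n :=
  (f ⊗ₜ[k] a : P.obj n ⊗[k] (permOperad k).obj n)

/-- The coefficient `f_i` of `∑ f_k ⊗ e_k`. -/
noncomputable def diCoord (P : Operad.{u} k) {n : ℕ} (i : Fin n) :
    (diOperad P).obj n →ₗ[k] P.obj n :=
  LinearMap.proj (φ := fun _ : Fin n => P.obj n) i ∘ₗ (diEquiv P n).toLinearMap

theorem diCoord_tmul (P : Operad.{u} k) {n : ℕ} (i : Fin n) (f : P.obj n)
    (a : (permOperad k).obj n) :
    diCoord P i (diTmul P f a) = permCoord a i • f := rfl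

theorem diCoord_ext (P : Operad.{u} k) {n : ℕ} {x y : (diOperad P).obj n}
    (h : ∀ i, diCoord P i x = diCoord P i y) : x = y :=
  (diEquiv P n).injective (funext h)

theorem diCoord_comp (P : Operad.{u} k) {n : ℕ} (m : Fin n → ℕ) (x : (diOperad P).obj n)
    (y : ∀ i, (diOperad P).obj (m i)) (i : Fin n) (j : Fin (m i)) :
    diCoord P (finSigmaFinEquiv ⟨i, j⟩) ((diOperad P).comp m x y) =
      P.comp m (diCoord P i x)
        (Function.update (fun i' => ∑ j, diCoord P j (y i')) i (diCoord P j (y i))) := by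
  refine (congrFun ((diEquiv P _).apply_symm_apply _) (finSigmaFinEquiv ⟨i, j⟩)).trans ?_
  exact piComp_apply P m _ _ i j

theorem diCoord_act (P : Operad.{u} k) {m n : ℕ} (σ : Fin m ≃ Fin n) (x : (diOperad P).obj m)
    (i : Fin m) :
    diCoord P (σ i) ((diOperad P).act σ x) = P.act σ (diCoord P i x) := by
  refine (congrFun ((diEquiv P _).apply_symm_apply _) (σ i)).trans ?_
  exact piAct_apply P σ _ i

theorem diCoord_one (P : Operad.{u} k) (i : Fin 1) : diCoord P i (diOperad P).one = P.one :=
  congrFun ((diEquiv P 1).apply_symm_apply (piOperad P).one) i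

theorem di_comp_tmul (P : Operad.{u} k) {n : ℕ} (m : Fin n → ℕ) (f : P.obj n)
    (a : (permOperad k).obj n) (g : ∀ i, P.obj (m i)) (b : ∀ i, (permOperad k).obj (m i)) :
    (diOperad P).comp m (diTmul P f a) (fun i => diTmul P (g i) (b i)) =
      diTmul P (P.comp m f g) ((permOperad k).comp m a b) := by
  refine diCoord_ext P fun q => ?_
  obtain ⟨⟨i, j⟩, rfl⟩ := finSigmaFinEquiv.surjective q
  rw [diCoord_comp, diCoord_tmul, diCoord_tmul, diCoord_tmul]
  refine Eq.trans ?_ (congrArg (· • P.comp m f g) (perm_comp_apply m a b i j)).symm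
  have h1 : (Function.update (fun i' => ∑ j, diCoord P j (diTmul P (g i') (b i'))) i
      (permCoord (b i) j • g i)) =
      fun i' => Function.update (fun i' => ∑ j, permCoord (b i') j) i
        (permCoord (b i) j) i' • g i' := by
    funext i'
    by_cases h : i' = i
    · subst h
      rw [Function.update_self, Function.update_self]
    · rw [Function.update_of_ne h, Function.update_of_ne h, Finset.sum_smul]
      rfl
  rw [h1, MultilinearMap.map_smul_univ, map_smul, smul_apply, smul_smul, mul_comm]

theorem di_act_tmul (P : Operad.{u} k) {m n : ℕ} (σ : Fin m ≃ Fin n) (f : P.obj m)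
    (a : (permOperad k).obj m) :
    (diOperad P).act σ (diTmul P f a) = diTmul P (P.act σ f) ((permOperad k).act σ a) := by
  refine diCoord_ext P fun q => ?_
  obtain ⟨i, rfl⟩ := σ.surjective q
  have : permCoord ((permOperad k).act σ a) (σ i) = permCoord a i :=
    piAct_apply (comOperad k) σ a i
  rw [diCoord_act, diCoord_tmul, diCoord_tmul, this, map_smul]

theorem di_one (P : Operad.{u} k) :
    (diOperad P).one = diTmul P P.one (permOperad k).one := by
  refine diCoord_ext P fun i => ?_
  rw [diCoord_one]
  exact (one_smul k P.one).symm

/-- The components `ω(n) ⊗ id` of the morphism `ω ⊗ id`. -/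
noncomputable def diMapAux {P Q : Operad.{u} k} (ω : Hom P Q) (n : ℕ) :
    (diOperad P).obj n →ₗ[k] (diOperad Q).obj n :=
  LinearMap.rTensor ((permOperad k).obj n) (ω.map n)

theorem diCoord_diMapAux {P Q : Operad.{u} k} (ω : Hom P Q) {n : ℕ} (i : Fin n)
    (x : (diOperad P).obj n) :
    diCoord Q i (diMapAux ω n x) = ω.map n (diCoord P i x) := by
  have : diCoord Q i ∘ₗ diMapAux ω n = ω.map n ∘ₗ diCoord P i := by
    refine TensorProduct.ext' fun f a => ?_
    refine (diCoord_tmul Q i (ω.map n f) a).trans ?_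
    rw [← map_smul]
    rfl
  exact LinearMap.congr_fun this x

/-- The morphism `ω ⊗ id : P ⊗ Perm → Q ⊗ Perm`. -/
noncomputable def diMap {P Q : Operad.{u} k} (ω : Hom P Q) : Hom (diOperad P) (diOperad Q) where
  map := diMapAux ω
  map_act σ f := diCoord_ext Q fun q => by
    obtain ⟨i, rfl⟩ := σ.surjective q
    simp only [diCoord_diMapAux, diCoord_act, ω.map_act]
  map_one := diCoord_ext Q fun i => by
    simp only [diCoord_diMapAux, diCoord_one, ω.map_one]
  map_comp {n} m f g := diCoord_ext Q fun q => by
    obtain ⟨⟨i, j⟩, rfl⟩ := finSigmaFinEquiv.surjective q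
    simp only [diCoord_diMapAux, diCoord_comp, ω.map_comp]
    refine congrArg _ (funext fun i' => ?_)
    by_cases h : i' = i
    · subst h
      simp
    · simp [h]

end PermOperad2

section Zeta

/-- The language `Ω^{(2)}`: symbols `s^κ` for `s ∈ Ω` and `κ = 1, …, ar s`. -/
abbrev Language.two (Ω : Language.{u}) : Language.{u} where
  Sym := (s : Ω.Sym) × Fin (Ω.ar s)
  ar s := Ω.ar s.1
  two_le s := Ω.two_le s.1

variable {k : Type u} [Field k] {Ω : Language.{u}} {X Y : Type}

/-- The term of type `Ω` obtained by erasing all superscripts. -/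
def Term.forget : Term Ω.two X → Term Ω X
  | .var x => .var x
  | .op s a => .op s.1 fun j => (a j).forget

/-- The emphasized variable of a term of type `Ω^{(2)}`: at a vertex `s^κ`, follow the `κ`-th
branch. -/
def Term.head : Term Ω.two X → X
  | .var x => x
  | .op s a => (a s.2).head

theorem Term.deg_forget (t : Term Ω.two X) : t.forget.deg = t.deg := by
  induction t with
  | var x => rfl
  | op s a ih => exact Finset.sum_congr rfl fun j _ => ih j

/-- Erasing all superscripts in a polynomial. -/
noncomputable def Poly.forget : Poly k Ω.two X →ₗ[k] Poly k Ω X :=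
  Finsupp.lmapDomain k k Term.forget

open Classical in
/-- Erasing all superscripts in those terms of a polynomial in which `x` is the emphasized
variable. -/
noncomputable def Poly.component (x : X) : Poly k Ω.two X →ₗ[k] Poly k Ω X :=
  Finsupp.linearCombination k fun t => if t.head = x then Finsupp.single t.forget 1 else 0

theorem Poly.component_single (x : X) (t : Term Ω.two X) (h : t.head = x) (c : k) :
    Poly.component x (Finsupp.single t c) = Finsupp.single t.forget c := by
  simp [Poly.component, h]

theorem Poly.component_single_of_ne (x : X) (t : Term Ω.two X) (h : t.head ≠ x) (c : k) :
    Poly.component x (Finsupp.single t c) = 0 := by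
  simp [Poly.component, h]

theorem Poly.forget_single (t : Term Ω.two X) (c : k) :
    Poly.forget (Finsupp.single t c) = Finsupp.single t.forget c := by
  simp [Poly.forget]

theorem Poly.sum_component [Fintype X] (f : Poly k Ω.two X) :
    ∑ x, Poly.component x f = Poly.forget f := by
  induction f using Finsupp.induction_linear with
  | zero => simp
  | add f f' h h' => simp only [map_add, Finset.sum_add_distrib, h, h']
  | single t c =>
    rw [Finset.sum_eq_single t.head
      (fun x _ hx => Poly.component_single_of_ne x t (Ne.symm hx) c) (by simp),
      Poly.component_single _ _ rfl, Poly.forget_single]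

theorem Poly.forget_var (x : X) : Poly.forget (Poly.var x : Poly k Ω.two X) = Poly.var x :=
  Poly.forget_single _ _

theorem Poly.component_var [DecidableEq X] (x y : X) :
    Poly.component y (Poly.var x : Poly k Ω.two X) = if x = y then Poly.var x else 0 := by
  split_ifs with h
  · exact Poly.component_single y (.var x) h 1
  · exact Poly.component_single_of_ne y (.var x) h 1

theorem Poly.forget_ops (s : Ω.two.Sym) (p : Fin (Ω.two.ar s) → Poly k Ω.two X) :
    Poly.forget (Poly.ops k Ω.two X s p) = Poly.ops k Ω X s.1 fun j => Poly.forget (p j) := by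
  have : Poly.forget.compMultilinearMap (Poly.ops k Ω.two X s) =
      (Poly.ops k Ω X s.1).compLinearMap fun _ => Poly.forget := by
    refine Module.Basis.ext_multilinear (fun _ => Finsupp.basisSingleOne) fun a => ?_
    simp only [Finsupp.coe_basisSingleOne, LinearMap.compMultilinearMap_apply,
      MultilinearMap.compLinearMap_apply, Poly.forget_single, Poly.ops_single]
    rfl
  exact DFunLike.congr_fun this p

theorem Poly.component_ops (x : X) (s : Ω.two.Sym) (p : Fin (Ω.two.ar s) → Poly k Ω.two X) :
    Poly.component x (Poly.ops k Ω.two X s p) = Poly.ops k Ω X s.1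
      (Function.update (fun j => Poly.forget (p j)) s.2 (Poly.component x (p s.2))) := by
  classical
  let L : Fin (Ω.ar s.1) → (Poly k Ω.two X →ₗ[k] Poly k Ω X) := fun j =>
    if j = s.2 then Poly.component x else Poly.forget
  have hL : ∀ p : Fin (Ω.ar s.1) → Poly k Ω.two X,
      Function.update (fun j => Poly.forget (p j)) s.2 (Poly.component x (p s.2)) =
        fun j => L j (p j) := by
    intro p
    funext j
    by_cases h : j = s.2
    · subst h; simp [L]
    · simp [L, h]
  have : (Poly.component x).compMultilinearMap (Poly.ops k Ω.two X s) =
      (Poly.ops k Ω X s.1).compLinearMap L := by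
    refine Module.Basis.ext_multilinear (fun _ => Finsupp.basisSingleOne) fun a => ?_
    simp only [Finsupp.coe_basisSingleOne, LinearMap.compMultilinearMap_apply,
      MultilinearMap.compLinearMap_apply]
    refine Eq.trans ?_ (congrArg (Poly.ops k Ω X s.1)
      (hL fun j => (Finsupp.single (a j) 1 : Poly k Ω.two X)))
    rw [Poly.ops_single]
    by_cases h : (a s.2).head = x
    · rw [Poly.component_single x (.op s a) h, Poly.component_single x _ h]
      have : Function.update (fun j => Poly.forget (Finsupp.single (a j) (1 : k))) s.2
          (Finsupp.single (a s.2).forget 1) = fun j => Finsupp.single (a j).forget 1 := by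
        funext j
        by_cases h : j = s.2
        · subst h; simp
        · simp [h, Poly.forget_single]
      rw [this]
      exact (Poly.ops_single (k := k) s.1 (fun j => (a j).forget) (fun _ => 1)).symm
    · rw [Poly.component_single_of_ne x (.op s a) h, Poly.component_single_of_ne x _ h]
      exact ((Poly.ops k Ω X s.1).map_coord_zero s.2 (by simp)).symm
  rw [hL]
  exact DFunLike.congr_fun this p

theorem Poly.forget_eval (g : X → Poly k Ω.two Y) (t : Term Ω.two X) :
    Poly.forget (t.eval (Poly.ops k Ω.two Y) g) =
      t.forget.eval (Poly.ops k Ω Y) fun x => Poly.forget (g x) := by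
  induction t with
  | var x => rfl
  | op s a ih =>
    exact (Poly.forget_ops s _).trans (congrArg (Poly.ops k Ω Y s.1) (funext ih))

theorem Term.deg_head_pos (t : Term Ω.two X) : 1 ≤ t.deg t.head := by
  induction t with
  | var x => simp [Term.deg, Term.head]
  | op s a ih =>
    simp only [Term.deg, Term.head, Finsupp.finsetSum_apply]
    exact (ih s.2).trans (Finset.single_le_sum (f := fun j => (a j).deg (a s.2).head)
      (fun _ _ => Nat.zero_le _) (Finset.mem_univ s.2))

theorem Poly.component_eval [DecidableEq X] (y : Y) (g : X → Poly k Ω.two Y) (t : Term Ω.two X)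
    (ht : t.deg t.head = 1) :
    Poly.component y (t.eval (Poly.ops k Ω.two Y) g) =
      t.forget.eval (Poly.ops k Ω Y) (Function.update (fun x => Poly.forget (g x)) t.head
        (Poly.component y (g t.head))) := by
  induction t with
  | var x => simp [Term.eval, Term.forget, Term.head]
  | op s a ih =>
    simp only [Term.eval, Term.forget, Term.head]
    refine (Poly.component_ops y s _).trans ?_
    simp only [Term.deg, Term.head, Finsupp.finsetSum_apply] at ht
    have hpos := (a s.2).deg_head_pos
    have hsum := Finset.add_sum_erase Finset.univ (fun j => (a j).deg (a s.2).head)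
      (Finset.mem_univ s.2)
    simp only [ht] at hsum
    refine congrArg _ (funext fun j => ?_)
    by_cases hj : j = s.2
    · subst hj
      rw [Function.update_self]
      exact ih s.2 (by omega)
    · rw [Function.update_of_ne hj, Poly.forget_eval, Term.eval_update_of_deg_eq_zero]
      rw [Term.deg_forget]
      have h : ∑ j ∈ Finset.univ.erase s.2, (a j).deg (a s.2).head = 0 := by omega
      exact Finset.sum_eq_zero_iff.mp h j (by simp [hj])

theorem component_mem {n : ℕ} (i : Fin n) (f : Poly k Ω.two (Fin n))
    (hf : f ∈ polylinear k Ω.two n) : Poly.component i f ∈ polylinear k Ω n := by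
  refine Submodule.sum_mem _ fun t ht => Submodule.smul_mem _ _ ?_
  have hd : t.deg = ones n := (Finsupp.mem_supported k _).mp hf ht
  beta_reduce
  split_ifs with h
  · exact Finsupp.single_mem_supported k _ (t.deg_forget.trans hd)
  · exact Submodule.zero_mem _

/-- Behaviour of the components under substitution into a polylinear polynomial. -/
theorem component_subst {n : ℕ} (y : Y) (g : Fin n → Poly k Ω.two Y) (f : Poly k Ω.two (Fin n))
    (hf : f ∈ polylinear k Ω.two n) :
    Poly.component y (Poly.subst g f) = ∑ i, Poly.subst
      (Function.update (fun i => Poly.forget (g i)) i (Poly.component y (g i)))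
      (Poly.component i f) := by
  have h : ∀ t ∈ f.support, Poly.component y (t.eval (Poly.ops k Ω.two Y) g) =
      ∑ i, Poly.subst
        (Function.update (fun i => Poly.forget (g i)) i (Poly.component y (g i)))
        (Poly.component i (Finsupp.single t (1 : k))) := by
    intro t ht
    rw [Poly.component_eval y g t (mem_polylinear_deg hf ht _), Finset.sum_eq_single t.head,
      Poly.component_single _ _ rfl, Poly.subst, Poly.eval_single, one_smul]
    · intro i _ hi
      rw [Poly.component_single_of_ne _ _ (Ne.symm hi), map_zero]
    · simp
  conv_rhs => rw [← Finsupp.sum_single f]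
  simp only [Finsupp.sum, map_sum]
  rw [Finset.sum_comm, Poly.subst, Poly.eval, Finsupp.linearCombination_apply, Finsupp.sum,
    map_sum]
  refine Finset.sum_congr rfl fun t ht => ?_
  rw [map_smul, h t ht, Finset.smul_sum]
  refine Finset.sum_congr rfl fun i _ => ?_
  rw [← map_smul, ← map_smul, Finsupp.smul_single_one]

/-- Substituting `0` for one variable annihilates a polylinear polynomial. -/
theorem subst_update_zero {n : ℕ} [DecidableEq (Fin n)] (i : Fin n) (g : Fin n → Poly k Ω Y)
    (f : Poly k Ω (Fin n))
    (hf : f ∈ polylinear k Ω n) : Poly.subst (Function.update g i 0) f = 0 := by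
  obtain ⟨l, hl⟩ := Poly.eval_update_of_deg_eq_one (Poly.ops k Ω Y) g i f
    fun t ht => mem_polylinear_deg hf ht i
  exact (hl 0).trans (map_zero l)

theorem toBlock_forget {n : ℕ} (m : Fin n → ℕ) (i : Fin n) (g : Poly k Ω.two (Fin (m i))) :
    Poly.forget (toBlock m i g) = toBlock m i (Poly.forget g) := by
  induction g using Finsupp.induction_linear with
  | zero => simp
  | add f f' h h' => simp only [map_add, h, h']
  | single t c =>
    simp only [toBlock, Poly.subst, Poly.eval_single, map_smul, Poly.forget_eval,
      Poly.forget_single, Poly.forget_var]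

theorem toBlock_component_self {n : ℕ} (m : Fin n → ℕ) (i : Fin n) (j : Fin (m i))
    (g : Poly k Ω.two (Fin (m i))) (hg : g ∈ polylinear k Ω.two (m i)) :
    Poly.component (finSigmaFinEquiv ⟨i, j⟩) (toBlock m i g) =
      toBlock m i (Poly.component j g) := by
  rw [toBlock, component_subst _ _ _ hg, Finset.sum_eq_single j]
  · simp only [Poly.component_var, Poly.forget_var, if_true, Function.update_eq_self]
    rfl
  · intro j' _ hj'
    rw [Poly.component_var, if_neg (by simpa using hj')]
    exact subst_update_zero _ _ _ (component_mem _ _ hg)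
  · simp

theorem toBlock_component_of_ne {n : ℕ} (m : Fin n → ℕ) {i i' : Fin n} (h : i' ≠ i)
    (j : Fin (m i))
    (g : Poly k Ω.two (Fin (m i'))) (hg : g ∈ polylinear k Ω.two (m i')) :
    Poly.component (finSigmaFinEquiv ⟨i, j⟩) (toBlock m i' g) = 0 := by
  rw [toBlock, component_subst _ _ _ hg]
  refine Finset.sum_eq_zero fun j' _ => ?_
  rw [Poly.component_var, if_neg]
  · exact subst_update_zero _ _ _ (component_mem _ _ hg)
  · intro h'
    exact h (congrArg Sigma.fst (finSigmaFinEquiv.injective h'))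

variable (k Ω)

/-- The coefficient of `e_i` in `ζ_Ω(f)`. -/
noncomputable def zetaComponent {n : ℕ} (i : Fin n) : polylinear k Ω.two n →ₗ[k] polylinear k Ω n :=
  (Poly.component i).restrict fun f hf => component_mem i f hf

theorem zetaComponent_coe {n : ℕ} (i : Fin n) (f : polylinear k Ω.two n) :
    (zetaComponent k Ω i f : Poly k Ω (Fin n)) = Poly.component i (f : Poly k Ω.two (Fin n)) := rfl

theorem zetaComponent_act {m n : ℕ} (σ : Fin m ≃ Fin n) (f : polylinear k Ω.two m) (i : Fin m) :
    zetaComponent k Ω (σ i) (freeAct σ f) = freeAct σ (zetaComponent k Ω i f) := by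
  refine Subtype.ext ?_
  rw [zetaComponent_coe, freeAct_coe, freeAct_coe, component_subst _ _ _ f.2,
    Finset.sum_eq_single i]
  · simp only [Poly.component_var, Poly.forget_var, if_true, Function.update_eq_self]
    rfl
  · intro j _ hj
    rw [Poly.component_var, if_neg (by simpa using hj)]
    exact subst_update_zero _ _ _ (component_mem _ _ f.2)
  · simp

theorem zetaComponent_comp {n : ℕ} (m : Fin n → ℕ) (f : polylinear k Ω.two n)
    (g : ∀ i, polylinear k Ω.two (m i)) (i : Fin n) (j : Fin (m i)) :
    zetaComponent k Ω (finSigmaFinEquiv ⟨i, j⟩) (freeComp m f g) =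
      freeComp m (zetaComponent k Ω i f)
        (Function.update (fun i' => ∑ j, zetaComponent k Ω j (g i')) i
          (zetaComponent k Ω j (g i))) := by
  refine Subtype.ext ?_
  rw [zetaComponent_coe, freeComp_coe, freeComp_coe]
  refine (component_subst _ _ _ f.2).trans ?_
  refine (Finset.sum_eq_single i ?_ ?_).trans ?_
  rotate_left 2
  · rw [toBlock_component_self _ _ _ _ (g i).2, zetaComponent_coe]
    congr 2
    funext i'
    by_cases h : i' = i
    · subst h
      simp [zetaComponent_coe]
    · simp [h, zetaComponent_coe, toBlock_forget, -map_sum, Poly.sum_component]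
  · intro i' _ hi'
    rw [toBlock_component_of_ne _ hi' _ _ (g i').2]
    exact subst_update_zero _ _ _ (component_mem _ _ f.2)
  · simp

/-- The components `ζ_Ω(n) : f ↦ ∑ f_i ⊗ e_i` of `ζ_Ω`, where `f_i` is obtained from the terms of
`f` with emphasized variable `x_i`. -/
noncomputable def zetaMap (n : ℕ) :
    (freeOperad k Ω.two).obj n →ₗ[k] (diOperad (freeOperad k Ω)).obj n :=
  (diEquiv (freeOperad k Ω) n).symm.toLinearMap ∘ₗ
    LinearMap.pi (φ := fun _ : Fin n => (freeOperad k Ω).obj n) fun i => zetaComponent k Ω i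

theorem diCoord_zetaMap {n : ℕ} (i : Fin n) (f : polylinear k Ω.two n) :
    diCoord (freeOperad k Ω) i (zetaMap k Ω n f) = zetaComponent k Ω i f :=
  congrFun ((diEquiv (freeOperad k Ω) n).apply_symm_apply _) i

/-- The morphism `ζ_Ω : 𝓕_{Ω^{(2)}} → 𝓕_Ω ⊗ Perm`, determined by
`s^κ(x₁, …, xₙ) ↦ s(x₁, …, xₙ) ⊗ e_κ` (see `zeta_generator`). -/
noncomputable def zeta : Hom (freeOperad k Ω.two) (diOperad (freeOperad k Ω)) where
  map := zetaMap k Ω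
  map_act σ f := diCoord_ext _ fun q => by
    obtain ⟨i, rfl⟩ := σ.surjective q
    rw [diCoord_act]
    refine (diCoord_zetaMap k Ω _ _).trans ?_
    exact (zetaComponent_act k Ω σ f i).trans
      (congrArg (freeAct σ) (diCoord_zetaMap k Ω i f).symm)
  map_one := diCoord_ext _ fun i => by
    rw [diCoord_one]
    refine (diCoord_zetaMap k Ω _ _).trans (Subtype.ext ?_)
    obtain rfl : i = 0 := Subsingleton.elim _ _
    exact Poly.component_single _ _ rfl _
  map_comp m f g := diCoord_ext _ fun q => by
    obtain ⟨⟨i, j⟩, rfl⟩ := finSigmaFinEquiv.surjective q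
    rw [diCoord_comp]
    refine (diCoord_zetaMap k Ω _ _).trans ?_
    have h1 : ∀ i j, diCoord (freeOperad k Ω) j (zetaMap k Ω (m i) (g i)) =
        zetaComponent k Ω j (g i) := fun i j => diCoord_zetaMap k Ω j (g i)
    have h2 : diCoord (freeOperad k Ω) i (zetaMap k Ω _ f) = zetaComponent k Ω i f :=
      diCoord_zetaMap k Ω i f
    refine (zetaComponent_comp k Ω m f g i j).trans ?_
    rw [h2]
    simp only [h1]
    rfl

variable {k Ω}

theorem generator_mem (s : Ω.Sym) :
    (Finsupp.single (Term.op s Term.var) 1 : Poly k Ω (Fin (Ω.ar s))) ∈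
      polylinear k Ω (Ω.ar s) := by
  refine Finsupp.single_mem_supported k _ ?_
  show ∑ j, Finsupp.single j 1 = ones _
  ext j
  simp [ones, Finsupp.finsetSum_apply, Finsupp.single_apply]

variable (k) in
/-- The element `s(x₁, …, xₙ)` of the free operad. -/
noncomputable def generator (s : Ω.Sym) : (freeOperad k Ω).obj (Ω.ar s) :=
  (⟨Finsupp.single (Term.op s Term.var) 1, generator_mem s⟩ : polylinear k Ω (Ω.ar s))

theorem zeta_generator (s : Ω.Sym) (κ : Fin (Ω.ar s)) :
    (zeta k Ω).map (Ω.ar s) (generator k (Ω := Ω.two) ⟨s, κ⟩) =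
      diTmul (freeOperad k Ω) (generator k s) (permBasis κ) := by
  refine diCoord_ext _ fun i => ?_
  refine (diCoord_zetaMap k Ω i _).trans ?_
  rw [diCoord_tmul, permCoord_basis]
  refine Subtype.ext ?_
  by_cases h : i = κ
  · subst h
    rw [if_pos rfl, one_smul]
    exact Poly.component_single _ _ rfl _
  · rw [if_neg h, zero_smul]
    exact Poly.component_single_of_ne _ _ (Ne.symm h) _

end Zeta

section Linearization

variable {k : Type u} [Field k] {Ω : Language.{u}}

theorem length_sort_toMultiset (d : ℕ →₀ ℕ) :
    (d.toMultiset.sort (· ≤ ·)).length = d.degree := by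
  rw [Multiset.length_sort, Finsupp.card_toMultiset]
  rfl

/-- For a multidegree `d` with `|d| = ∑ d i`, the weakly increasing map from the `|d|` new
variables to the old ones under which `d i` new variables are assigned to every `x_i`. -/
noncomputable def block (d : ℕ →₀ ℕ) (j : Fin d.degree) : ℕ :=
  (d.toMultiset.sort (· ≤ ·)).get (j.cast (length_sort_toMultiset d).symm)

/-- The complete linearization `L(f)` with respect to the multidegree `d`: substitute for every
variable `x_i` the sum of `d i` new variables, all these new variables being different, and take
the part of the result which is linear in each of the `|d|` new variables. -/
noncomputable def linearize (d : ℕ →₀ ℕ) (f : Poly k Ω ℕ) : polylinear k Ω d.degree :=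
  open Classical in
  ⟨(Poly.subst (fun i => ∑ j with block d j = i, Poly.var j) f).filter
    fun t => t.deg = ones d.degree,
    (Finsupp.mem_supported k _).mpr fun _ ht => (Finset.mem_filter.mp ht).2⟩

end Linearization

section Identities

variable {k : Type u} [Field k]

/-- The structure of an algebra of type `Ω` given by a morphism `𝓕_Ω → ℰ(A)`. -/
noncomputable def Hom.algStructure {Ω : Language.{u}} {A : Type u} [AddCommGroup A] [Module k A]
    (α : Hom (freeOperad k Ω) (endOperad k A)) : AlgStructure k Ω A :=
  fun s => α.map (Ω.ar s) (generator k s)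

/-- For a `P`-algebra `(A, α)`, where `P` is an operad with a morphism `π : 𝓕_Ω → P`: the
polynomial identity `f = 0` holds on `A`, considered as an algebra of type `Ω`. -/
def Satisfies {Ω : Language.{u}} {P : Operad.{u} k} (π : Hom (freeOperad k Ω) P) {A : Type u}
    [AddCommGroup A] [Module k A] (α : Hom P (endOperad k A)) {X : Type} (f : Poly k Ω X) : Prop :=
  ∀ v : X → A, Poly.eval (α.comp π).algStructure v f = 0

/-- A `P`-algebra `(A, α)` is `ω`-special, `ω : P → R`, if `α = β ∘ ω` for an `R`-algebra
`(A, β)`. -/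
def IsSpecial {P R : Operad.{u} k} (ω : Hom P R) {A : Type u} [AddCommGroup A] [Module k A]
    (α : Hom P (endOperad k A)) : Prop :=
  ∃ β : Hom R (endOperad k A), α = β.comp ω

/-- `f = 0` is an identity on all `P`-algebras. -/
def IsIdentity {Ω : Language.{u}} {P : Operad.{u} k} (π : Hom (freeOperad k Ω) P) {X : Type}
    (f : Poly k Ω X) : Prop :=
  ∀ (A : Type u) [AddCommGroup A] [Module k A] (α : Hom P (endOperad k A)), Satisfies π α f

/-- `f = 0` is an identity on all `ω`-special `P`-algebras. -/
def IsSpecialIdentity {Ω : Language.{u}} {P R : Operad.{u} k} (π : Hom (freeOperad k Ω) P)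
    (ω : Hom P R) {X : Type} (f : Poly k Ω X) : Prop :=
  ∀ (A : Type u) [AddCommGroup A] [Module k A] (α : Hom P (endOperad k A)),
    IsSpecial ω α → Satisfies π α f

/-- The morphism `π^{(2)} = (π ⊗ id) ∘ ζ_Ω : 𝓕_{Ω^{(2)}} → diP`. -/
noncomputable def piTwo {Ω : Language.{u}} {P : Operad.{u} k} (π : Hom (freeOperad k Ω) P) :
    Hom (freeOperad k Ω.two) (diOperad P) :=
  (diMap π).comp (zeta k Ω)

end Identities

end DiOperad

open DiOperad

/-! Special `P`-algebras are exactly the `R`-algebras restricted along the given morphism, so a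
special identity is an ordinary identity for a composite morphism out of a free operad: `𝓕_Ω → P →
R` on one side, `𝓕_{Ω^{(2)}} → diP → diR` on the other (`isSpecialIdentity_iff`). Both halves of
(S1) thus become questions of one kind, about a morphism `φ` from a free operad, and three facts
settle them.

In characteristic 0 a polynomial is an identity if and only if all its complete linearizations are,
and for a homogeneous one the linearization at its own multidegree is enough
(`isIdentity_iff_linearize`, `isIdentity_iff_linearize_of_homogeneous`). If the arguments are scaled
and a linear functional is applied to the value, the result is a polynomial in the scalars whose
coefficients are the values of the homogeneous parts. Identifying the new variables of each block in
`L_d(f)` gives back the part of multidegree `d` times `∏ d_i!`, which is invertible.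

A polylinear polynomial is an identity if and only if `φ` kills it, provided that the target of `φ`
is a quotient of some free operad (`isIdentity_iff_map_eq_zero`). Such a target acts faithfully in
arity `n` on its relatively free algebra with `n` generators (`exists_faithful_algebra`). The
targets `diP` and `diR` qualify because `ζ` is surjective (`zeta_isQuotient`): suitable superscripts
make any variable occurring in a term the emphasized one.

Finally, `π ⊗ id` and `ω ⊗ id` act separately on the coefficients of the basis `e_k`. Hence `∑ f_k ⊗
e_k` is killed precisely when every `f_k` is, which matches identities of dialgebras with identities
of all the components (`isIdentity_piTwo_iff`, `isSpecialIdentity_piTwo_iff`). -/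

namespace DiOperad

/-! ### Morphisms out of the free operad and evaluation of polylinear polynomials. -/

section FreeOperadHom

variable {k : Type u} [Field k] {Ω : Language.{u}} {X : Type}

/-- The coefficient at `q` counts the preimages of `q`, so every fibre has exactly one element. This
is how a renaming of variables with polylinear result is recognized as a permutation. -/
theorem bijective_of_sum_single {ι : Type*} [Fintype ι] {n : ℕ} (l : ι → Fin n)
    (h : ∑ i, Finsupp.single (l i) 1 = ones n) : Function.Bijective l := by
  classical
  refine (Function.bijective_iff_existsUnique l).mpr fun q => ?_
  have hq := DFunLike.congr_fun h q
  have hc : (Finset.univ.filter fun i => l i = q).card = 1 := by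
    simpa [ones, Finsupp.finsetSum_apply, Finsupp.single_apply] using hq
  obtain ⟨i, hi⟩ := Finset.card_eq_one.mp hc
  have hm : ∀ j, l j = q ↔ j = i := fun j => by
    simpa using Finset.ext_iff.mp hi j
  exact ⟨i, (hm i).mpr rfl, fun j hj => (hm j).mp hj⟩

theorem subst_generator (s : Ω.Sym) (g : Fin (Ω.ar s) → Poly k Ω X) :
    Poly.subst g (Finsupp.single (Term.op s Term.var) 1) = Poly.ops k Ω X s g := by
  rw [Poly.subst, Poly.eval_single, one_smul]
  rfl

/-- Substituting into the variables of a composition amounts to substituting blockwise. -/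
theorem subst_freeComp {n : ℕ} (m : Fin n → ℕ) (f : polylinear k Ω n)
    (p : ∀ i, polylinear k Ω (m i)) (g : ∀ i, Fin (m i) → Poly k Ω X) :
    Poly.subst (fun q => g (finSigmaFinEquiv.symm q).1 (finSigmaFinEquiv.symm q).2)
        (freeComp m f p : Poly k Ω (Fin (∑ i, m i))) =
      Poly.subst (fun i => Poly.subst (g i) (p i : Poly k Ω (Fin (m i)))) (f : Poly k Ω (Fin n)) := by
  rw [freeComp_coe, Poly.subst_subst]
  have h : ∀ p p' : (i : Fin n) × Fin (m i), p = p' → g p.1 p.2 = g p'.1 p'.2 := by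
    rintro p _ rfl
    rfl
  congr 2
  funext i
  rw [toBlock, Poly.subst_subst]
  congr 2
  funext j
  rw [Poly.subst_var]
  exact h _ ⟨i, j⟩ (Equiv.symm_apply_apply _ _)

/-- Every term is obtained from an iterated composition of generators by renaming variables. -/
theorem Term.exists_shape (M : ∀ n, polylinear k Ω n → Prop)
    (hone : M 1 ⟨Poly.var 0, var_mem_polylinear⟩)
    (hcomp : ∀ (s : Ω.Sym) (m : Fin (Ω.ar s) → ℕ) (p : ∀ i, polylinear k Ω (m i)),
      (∀ i, M (m i) (p i)) → M _ (freeComp m ⟨_, generator_mem s⟩ p)) (t : Term Ω X) :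
    ∃ (n : ℕ) (p : polylinear k Ω n) (l : Fin n → X), M n p ∧
      Poly.subst (fun i => Poly.var (l i)) (p : Poly k Ω (Fin n)) = Finsupp.single t 1 := by
  -- `M` turns the statement into an induction principle: `Hom.ext_generator` uses it for the
  -- equality of two morphisms, while `map_polylinearPart_subst` needs only the shape and takes the
  -- trivial predicate.
  induction t with
  | var x => exact ⟨1, _, fun _ => x, hone, Poly.subst_var _ _⟩
  | op s a ih =>
    choose m p l hM hp using ih
    refine ⟨_, _, fun q => l (finSigmaFinEquiv.symm q).1 (finSigmaFinEquiv.symm q).2,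
      hcomp s m p hM, ?_⟩
    refine (subst_freeComp m _ p fun i j => Poly.var (l i j)).trans ?_
    simp only [hp]
    rw [subst_generator, Poly.ops_single]
    simp

theorem Term.deg_eq_sum_single {n : ℕ} (p : polylinear k Ω n) (l : Fin n → X) (t : Term Ω X)
    (h : Poly.subst (fun i => Poly.var (l i)) (p : Poly k Ω (Fin n)) = Finsupp.single t 1) :
    t.deg = ∑ i, Finsupp.single (l i) 1 := by
  have h1 := Poly.subst_mem_homogeneous (fun i => (Poly.var (l i) : Poly k Ω X)) _
    (fun i => var_mem_homogeneous _) _ _ p.2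
  rw [ones_sum, h] at h1
  exact (Finsupp.mem_supported k _).mp h1 (by simp)

/-- A morphism from the free operad is determined by its values on the generators. -/
theorem Hom.ext_generator {Q : Operad.{u} k} {φ ψ : Hom (freeOperad k Ω) Q}
    (h : ∀ s, φ.map _ (generator k s) = ψ.map _ (generator k s)) (n : ℕ) (p : polylinear k Ω n) :
    φ.map n p = ψ.map n p := by
  have hterm : ∀ (t : Term Ω (Fin n)) (ht : t.deg = ones n),
      φ.map n (⟨Finsupp.single t 1, Finsupp.single_mem_supported k _ ht⟩ : polylinear k Ω n) =
        ψ.map n (⟨Finsupp.single t 1, Finsupp.single_mem_supported k _ ht⟩ : polylinear k Ω n) := by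
    intro t ht
    obtain ⟨m, q, l, hq, hl⟩ := Term.exists_shape (k := k)
      (fun n q => φ.map n q = ψ.map n q) (φ.map_one.trans ψ.map_one.symm)
      (fun s m p hp => by
        refine (φ.map_comp m (generator k s) p).trans
          (Eq.trans ?_ (ψ.map_comp m (generator k s) p).symm)
        rw [h s]
        exact congrArg _ (funext hp)) t
    -- Since `t` is polylinear, the renaming `l` is a bijection and `t` is obtained from `q` by the
    -- operad action, with which both morphisms commute.
    have hb := bijective_of_sum_single l ((Term.deg_eq_sum_single q l t hl).symm.trans ht)
    have he : (⟨Finsupp.single t 1, Finsupp.single_mem_supported k _ ht⟩ : polylinear k Ω n) =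
        freeAct (Equiv.ofBijective l hb) q := Subtype.ext hl.symm
    rw [he]
    refine (φ.map_act (Equiv.ofBijective l hb) q).trans
      (Eq.trans ?_ (ψ.map_act (Equiv.ofBijective l hb) q).symm)
    rw [hq]
  have hp : p = ∑ t : (p : Poly k Ω (Fin n)).support, (p : Poly k Ω (Fin n)) t •
      (⟨Finsupp.single t.1 1, Finsupp.single_mem_supported k _
        ((Finsupp.mem_supported k _).mp p.2 t.2)⟩ : polylinear k Ω n) := by
    refine Subtype.ext ?_
    rw [Submodule.coe_sum]
    simp only [Submodule.coe_smul, Finsupp.smul_single_one]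
    rw [Finset.sum_coe_sort (p : Poly k Ω (Fin n)).support
      fun t => Finsupp.single t ((p : Poly k Ω (Fin n)) t)]
    exact (Finsupp.sum_single _).symm
  rw [hp]
  refine (map_sum (φ.map n) _ _).trans (Eq.trans ?_ (map_sum (ψ.map n) _ _).symm)
  refine Finset.sum_congr rfl fun t _ => ?_
  refine (map_smul (φ.map n) _ _).trans (Eq.trans ?_ (map_smul (ψ.map n) _ _).symm)
  exact congrArg _ (hterm t.1 ((Finsupp.mem_supported k _).mp p.2 t.2))

variable {A : Type u} [AddCommGroup A] [Module k A]

/-- An element of `ℰ(A)(n)` as a multilinear map. -/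
abbrev toMultilinearMap {n : ℕ} (x : (endOperad k A).obj n) :
    MultilinearMap k (fun _ : Fin n => A) A := x

/-- The evaluation of a polylinear polynomial as a multilinear map. -/
noncomputable def polylinearEval (ops : AlgStructure k Ω A) {n : ℕ} (p : polylinear k Ω n) :
    MultilinearMap k (fun _ : Fin n => A) A where
  toFun v := Poly.eval ops v (p : Poly k Ω (Fin n))
  map_update_add' v i x y := by
    obtain ⟨l, hl⟩ := Poly.eval_update_of_deg_eq_one ops v i p.1
      fun t ht => mem_polylinear_deg p.2 ht i
    simp only [hl, map_add]
  map_update_smul' v i c x := by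
    obtain ⟨l, hl⟩ := Poly.eval_update_of_deg_eq_one ops v i p.1
      fun t ht => mem_polylinear_deg p.2 ht i
    simp only [hl, map_smul]

/-- The morphism `𝓕_Ω → ℰ(A)` given by a structure of an algebra of type `Ω` on `A`. -/
noncomputable def structureHom (ops : AlgStructure k Ω A) :
    Hom (freeOperad k Ω) (endOperad k A) where
  map n :=
    { toFun := fun p : polylinear k Ω n => polylinearEval ops p
      map_add' := fun p q => MultilinearMap.ext fun v =>
        map_add (Poly.eval ops v) (p : polylinear k Ω n).1 (q : polylinear k Ω n).1
      map_smul' := fun c p => MultilinearMap.ext fun v =>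
        map_smul (Poly.eval ops v) c (p : polylinear k Ω n).1 }
  map_act {m n} σ f := MultilinearMap.ext fun v => by
    refine (Poly.eval_subst ops v _ (f : polylinear k Ω m).1).trans ?_
    simp only [Poly.eval_var]
    rfl
  map_one := MultilinearMap.ext fun v => Poly.eval_var ops v 0
  map_comp {n} m f g := MultilinearMap.ext fun v => by
    refine (Poly.eval_subst ops v _ (f : polylinear k Ω n).1).trans ?_
    simp only [toBlock, Poly.eval_subst, Poly.eval_var]
    rfl

theorem structureHom_apply (ops : AlgStructure k Ω A) {n : ℕ} (p : polylinear k Ω n)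
    (v : Fin n → A) :
    toMultilinearMap ((structureHom ops).map n p) v = Poly.eval ops v (p : Poly k Ω (Fin n)) := rfl

/-- The bridge between identities and operads: evaluation in the algebra of type `Ω` attached to `φ`
is itself a morphism of operads, it agrees with `φ` on generators, and generators determine a
morphism. -/
theorem Hom.eval_algStructure (φ : Hom (freeOperad k Ω) (endOperad k A)) {n : ℕ}
    (p : polylinear k Ω n) (v : Fin n → A) :
    Poly.eval φ.algStructure v (p : Poly k Ω (Fin n)) = toMultilinearMap (φ.map n p) v := by
  rw [← structureHom_apply]
  refine congrArg (fun x => toMultilinearMap x v) (Hom.ext_generator (fun s => ?_) n p)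
  refine MultilinearMap.ext fun w => ?_
  refine (Poly.eval_single _ _ _ _).trans (one_smul _ _)

end FreeOperadHom

end DiOperad

namespace DiOperad

/-! ### Relatively free algebras and faithful actions of quotients of free operads. -/

section FaithfulAlgebra

variable {k : Type u} [Field k]

/-- A morphism vanishing on the kernel of a quotient morphism factors through it. -/
theorem Hom.exists_factor {P Q S : Operad.{u} k} (φ : Hom P Q) (hφ : φ.IsQuotient) (ψ : Hom P S)
    (h : ∀ n (p : P.obj n), φ.map n p = 0 → ψ.map n p = 0) :
    ∃ β : Hom Q S, ∀ n (p : P.obj n), β.map n (φ.map n p) = ψ.map n p := by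
  -- The linear sections are chosen arity by arity and need not respect the operad structure. This
  -- is harmless: `ψ` kills the kernel of `φ`, so `ψ ∘ s` does not depend on them.
  choose s hs using fun n => (φ.map n).exists_rightInverse_of_surjective
    (LinearMap.range_eq_top.mpr (hφ n))
  have hβ : ∀ n (p : P.obj n), (ψ.map n ∘ₗ s n) (φ.map n p) = ψ.map n p := fun n p => by
    rw [← sub_eq_zero, LinearMap.comp_apply, ← map_sub]
    apply h
    rw [map_sub, sub_eq_zero]
    exact LinearMap.congr_fun (hs n) _
  refine ⟨⟨fun n => ψ.map n ∘ₗ s n, fun {m n} σ f => ?_, ?_, fun {n} m f g => ?_⟩, hβ⟩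
  · obtain ⟨p, rfl⟩ := hφ _ f
    rw [← φ.map_act, hβ, hβ, ψ.map_act]
  · rw [← φ.map_one, hβ, ψ.map_one]
  · obtain ⟨p, rfl⟩ := hφ _ f
    choose q hq using fun i => hφ _ (g i)
    obtain rfl : (fun i => φ.map _ (q i)) = g := funext hq
    rw [← φ.map_comp, hβ, hβ, ψ.map_comp]
    exact congrArg _ (funext fun i => (hβ _ (q i)).symm)

/-- Pass from `g'` to `g` one coordinate at a time; each change alters the value by `N` with an
element of `T` in one slot, which is zero. -/
theorem MultilinearMap.congr_of_sub_mem {ι : Type*} [Fintype ι] [DecidableEq ι] {V W : Type*}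
    [AddCommGroup V] [Module k V] [AddCommGroup W] [Module k W] (N : MultilinearMap k (fun _ : ι => V) W)
    (T : Submodule k V) (hN : ∀ (a : ι → V) (j : ι), ∀ z ∈ T, N (Function.update a j z) = 0)
    (g g' : ι → V) (h : ∀ i, g i - g' i ∈ T) : N g = N g' := by
  have key : ∀ s : Finset ι, N (s.piecewise g g') = N g' := by
    intro s
    induction s using Finset.induction_on with
    | empty => simp
    | insert j s hj ih =>
      rw [Finset.piecewise_insert, ← ih, ← sub_eq_zero]
      have h1 : N (s.piecewise g g') = N (Function.update (s.piecewise g g') j (g' j)) := by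
        rw [← Finset.piecewise_eq_of_notMem s g g' hj, Function.update_eq_self]
      rw [h1, ← N.map_update_sub]
      exact hN _ _ _ (h j)
  simpa using key Finset.univ

variable {Ω : Language.{u}} {X : Type}

theorem Poly.map_eval {A B : Type u} [AddCommGroup A] [Module k A] [AddCommGroup B] [Module k B]
    (ops : AlgStructure k Ω A) (ops' : AlgStructure k Ω B) (L : A →ₗ[k] B)
    (hL : ∀ s a, L (ops s a) = ops' s fun i => L (a i)) (v : X → A) (f : Poly k Ω X) :
    L (Poly.eval ops v f) = Poly.eval ops' (fun x => L (v x)) f := by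
  have ht : ∀ t : Term Ω X, L (t.eval ops v) = t.eval ops' fun x => L (v x) := by
    intro t
    induction t with
    | var x => rfl
    | op s a ih => simp only [Term.eval, hL, ih]
  induction f using Finsupp.induction_linear with
  | zero => simp
  | add f f' h h' => simp only [map_add, h, h']
  | single t c => simp only [Poly.eval_single, map_smul, ht]

variable {R : Operad.{u} k}

/-- The ideal of all consequences in `𝓕_Ω⟨X⟩` of the kernel of a morphism from `𝓕_Ω`. -/
noncomputable def verbalIdeal (ρ : Hom (freeOperad k Ω) R) (X : Type) : Submodule k (Poly k Ω X) :=
  Submodule.span k {q | ∃ (m : ℕ) (p : polylinear k Ω m) (g : Fin m → Poly k Ω X),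
    ρ.map m p = 0 ∧ Poly.subst g (p : Poly k Ω (Fin m)) = q}

theorem subst_mem_verbalIdeal (ρ : Hom (freeOperad k Ω) R) {m : ℕ} (p : polylinear k Ω m)
    (hp : ρ.map m p = 0) (g : Fin m → Poly k Ω X) :
    Poly.subst g (p : Poly k Ω (Fin m)) ∈ verbalIdeal ρ X :=
  Submodule.subset_span ⟨m, p, g, hp, rfl⟩

/-- The verbal ideal is an ideal. Inserting `p(g)` into one slot of `s` is again a substitution into
an element of the kernel, namely the operadic composition of the generator `s` with `p` in slot `j`
and the unit elsewhere; `ρ` kills it because a multilinear map vanishes when one argument is zero.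
-/
theorem ops_update_mem_verbalIdeal (ρ : Hom (freeOperad k Ω) R) (s : Ω.Sym)
    (a : Fin (Ω.ar s) → Poly k Ω X) (j : Fin (Ω.ar s)) (z : Poly k Ω X)
    (hz : z ∈ verbalIdeal ρ X) :
    Poly.ops k Ω X s (Function.update a j z) ∈ verbalIdeal ρ X := by
  induction hz using Submodule.span_induction with
  | zero => rw [MultilinearMap.map_update_zero]; exact Submodule.zero_mem _
  | add x y _ _ hx hy => rw [MultilinearMap.map_update_add]; exact Submodule.add_mem _ hx hy
  | smul c x _ hx => rw [MultilinearMap.map_update_smul]; exact Submodule.smul_mem _ _ hx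
  | mem z hz =>
    obtain ⟨m, p, g, hp, rfl⟩ := hz
    have hex : ∀ i, ∃ (m' : ℕ) (p' : polylinear k Ω m') (g' : Fin m' → Poly k Ω X),
        Poly.subst g' (p' : Poly k Ω (Fin m')) =
          Function.update a j (Poly.subst g (p : Poly k Ω (Fin m))) i ∧
        (i = j → ρ.map m' p' = 0) := by
      intro i
      by_cases h : i = j
      · subst h
        exact ⟨m, p, g, by simp, fun _ => hp⟩
      -- In the other slots the operad unit is composed and `a i` is substituted for its only
      -- variable.
      · exact ⟨1, ⟨Poly.var 0, var_mem_polylinear⟩, fun _ => a i,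
          by simp [h, Poly.subst_var], fun h' => absurd h' h⟩
    choose m' p' g' h1 h2 using hex
    have h3 : ρ.map _ (freeComp m' (⟨_, generator_mem s⟩ : polylinear k Ω _) p') = 0 :=
      (ρ.map_comp m' (generator k s) p').trans
        (MultilinearMap.map_coord_zero _ j (h2 j rfl))
    have h4 := subst_mem_verbalIdeal ρ _ h3
      (fun q => g' (finSigmaFinEquiv.symm q).1 (finSigmaFinEquiv.symm q).2)
    rw [subst_freeComp] at h4
    simp only [h1] at h4
    rwa [subst_generator] at h4

/-- The operations are transported through a linear section of the quotient map, which makes their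
multilinearity automatic. Compatibility with the projection then follows because the section changes
arguments only by elements of the ideal. -/
theorem exists_quotient_structure (ρ : Hom (freeOperad k Ω) R) (X : Type) :
    ∃ ops : AlgStructure k Ω (Poly k Ω X ⧸ verbalIdeal ρ X), ∀ s a,
      (verbalIdeal ρ X).mkQ (Poly.ops k Ω X s a) = ops s fun i => (verbalIdeal ρ X).mkQ (a i) := by
  obtain ⟨σ, hσ⟩ := (verbalIdeal ρ X).mkQ.exists_rightInverse_of_surjective
    (verbalIdeal ρ X).range_mkQ
  refine ⟨fun s => (verbalIdeal ρ X).mkQ.compMultilinearMap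
    ((Poly.ops k Ω X s).compLinearMap fun _ => σ), fun s a => ?_⟩
  refine MultilinearMap.congr_of_sub_mem
    ((verbalIdeal ρ X).mkQ.compMultilinearMap (Poly.ops k Ω X s)) (verbalIdeal ρ X)
    (fun a j z hz => ?_) _ _ fun i => ?_
  · exact (Submodule.Quotient.mk_eq_zero _).mpr (ops_update_mem_verbalIdeal ρ s a j z hz)
  · exact (Submodule.Quotient.eq _).mp (LinearMap.congr_fun hσ ((verbalIdeal ρ X).mkQ (a i))).symm

open Classical in
/-- The polylinear part of a polynomial. -/
noncomputable def polylinearPart (k : Type u) [Field k] (Ω : Language.{u}) (n : ℕ) :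
    Poly k Ω (Fin n) →ₗ[k] polylinear k Ω n :=
  Finsupp.restrictDom k k {t : Term Ω (Fin n) | t.deg = ones n}

theorem polylinearPart_coe {n : ℕ} (p : polylinear k Ω n) :
    polylinearPart k Ω n (p : Poly k Ω (Fin n)) = p := by
  classical
  refine Subtype.ext ?_
  refine (Finsupp.restrictDom_apply _ _).trans ?_
  exact Finsupp.filter_eq_self_iff _ _ |>.mpr fun t ht =>
    (Finsupp.mem_supported k _).mp p.2 (Finsupp.mem_support_iff.mpr ht)

theorem polylinearPart_eq_zero {n : ℕ} {d : Fin n →₀ ℕ} (hd : d ≠ ones n) (f : Poly k Ω (Fin n))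
    (hf : f ∈ Poly.homogeneous k Ω d) : polylinearPart k Ω n f = 0 := by
  classical
  refine Subtype.ext ?_
  refine (Finsupp.restrictDom_apply _ _).trans ?_
  exact Finsupp.filter_eq_zero_iff _ _ |>.mpr fun t ht => by
    by_contra h
    exact hd (((Finsupp.mem_supported k _).mp hf (Finsupp.mem_support_iff.mpr h)).symm.trans ht)

/-- This says that the verbal ideal contains no polylinear element outside the kernel of `ρ`. An
arbitrary substitution may identify variables or produce other degrees, so the claim is made for the
polylinear part of the result. -/
theorem map_polylinearPart_subst (ρ : Hom (freeOperad k Ω) R) {m n : ℕ} (p : polylinear k Ω m)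
    (hp : ρ.map m p = 0) (g : Fin m → Poly k Ω (Fin n)) :
    ρ.map n (polylinearPart k Ω n (Poly.subst g (p : Poly k Ω (Fin m)))) = 0 := by
  let N : MultilinearMap k (fun _ : Fin m => Poly k Ω (Fin n)) (R.obj n) :=
    ((ρ.map n).comp (polylinearPart k Ω n)).compMultilinearMap
      (polylinearEval (Poly.ops k Ω (Fin n)) p)
  suffices N = 0 from DFunLike.congr_fun this g
  -- By multilinearity in the substituted polynomials these may be taken to be terms. Each term is a
  -- renaming of a polylinear `q i`, so the result is a renaming of the composition of `p` with the
  -- `q i`.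
  refine Module.Basis.ext_multilinear (fun _ => Finsupp.basisSingleOne) fun t => ?_
  simp only [Finsupp.coe_basisSingleOne]
  show ρ.map n (polylinearPart k Ω n (Poly.subst (fun i => Finsupp.single (t i) 1)
    (p : Poly k Ω (Fin m)))) = 0
  choose m' q l _ hq using fun i => Term.exists_shape (k := k) (fun _ _ => True) trivial
    (fun _ _ _ _ => trivial) (t i)
  have h1 := subst_freeComp m' p q fun i j => Poly.var (l i j)
  simp only [hq] at h1
  rw [← h1]
  have h2 := Poly.subst_mem_homogeneous (fun r => (Poly.var (l (finSigmaFinEquiv.symm r).1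
    (finSigmaFinEquiv.symm r).2) : Poly k Ω (Fin n))) _
    (fun i => var_mem_homogeneous _) _ _ (freeComp m' p q).2
  rw [ones_sum] at h2
  -- Either the renaming is a bijection, and the result is a permutation of a composition with `p`,
  -- killed by `ρ`; or its multidegree differs from `(1, …, 1)` and it has no polylinear part.
  by_cases hd : ∑ r, Finsupp.single (l (finSigmaFinEquiv.symm r).1
      (finSigmaFinEquiv.symm r).2) 1 = ones n
  · have h3 : Poly.subst (fun r => Poly.var (l (finSigmaFinEquiv.symm r).1
        (finSigmaFinEquiv.symm r).2)) (freeComp m' p q : Poly k Ω _) =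
        (freeAct (Equiv.ofBijective _ (bijective_of_sum_single _ hd)) (freeComp m' p q) :
          Poly k Ω (Fin n)) := rfl
    rw [h3, polylinearPart_coe]
    refine (ρ.map_act _ (freeComp m' p q)).trans ?_
    have h4 : ρ.map _ (freeComp m' p q) = 0 := by
      refine (ρ.map_comp m' p q).trans ?_
      rw [hp, map_zero]
      rfl
    rw [h4, map_zero]
  · rw [polylinearPart_eq_zero hd _ h2]
    exact map_zero _

/-- A quotient of the free operad acts faithfully in every arity on some algebra. -/
theorem exists_faithful_algebra (ρ : Hom (freeOperad k Ω) R) (hρ : ρ.IsQuotient) (n : ℕ) :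
    ∃ (A : Type u) (_ : AddCommGroup A) (_ : Module k A) (β : Hom R (endOperad k A)),
      ∀ r, β.map n r = 0 → r = 0 := by
  obtain ⟨ops, hops⟩ := exists_quotient_structure ρ (Fin n)
  have heval : ∀ {m : ℕ} (g : Fin m → Poly k Ω (Fin n)) (p : Poly k Ω (Fin m)),
      Poly.eval ops (fun i => (verbalIdeal ρ (Fin n)).mkQ (g i)) p =
        (verbalIdeal ρ (Fin n)).mkQ (Poly.subst g p) := fun g p =>
    (Poly.map_eval (Poly.ops k Ω (Fin n)) ops _ hops g p).symm
  obtain ⟨β, hβ⟩ := Hom.exists_factor ρ hρ (structureHom ops) fun m p hp =>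
    MultilinearMap.ext fun v => by
      choose g hg using fun i => (verbalIdeal ρ (Fin n)).mkQ_surjective (v i)
      obtain rfl : (fun i => (verbalIdeal ρ (Fin n)).mkQ (g i)) = v := funext hg
      refine (heval g _).trans ?_
      exact (Submodule.Quotient.mk_eq_zero _).mpr (subst_mem_verbalIdeal ρ p hp g)
  refine ⟨_, inferInstance, inferInstance, β, fun r hr => ?_⟩
  obtain ⟨p, rfl⟩ := hρ n r
  rw [hβ] at hr
  -- Evaluating at the classes of the free generators shows that `p` lies in the verbal ideal.
  have h1 : Poly.eval ops (fun i => (verbalIdeal ρ (Fin n)).mkQ (Poly.var i))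
      (p : polylinear k Ω n).1 = 0 :=
    DFunLike.congr_fun (F := MultilinearMap k (fun _ : Fin n => _) _) hr _
  rw [heval, Poly.subst_id] at h1
  have h2 : (p : polylinear k Ω n).1 ∈ verbalIdeal ρ (Fin n) :=
    (Submodule.Quotient.mk_eq_zero _).mp h1
  have h3 : verbalIdeal ρ (Fin n) ≤ LinearMap.ker ((ρ.map n).comp (polylinearPart k Ω n)) := by
    refine Submodule.span_le.mpr ?_
    rintro _ ⟨m, q, g, hq, rfl⟩
    exact map_polylinearPart_subst ρ q hq g
  have h4 : ρ.map n (polylinearPart k Ω n (p : polylinear k Ω n).1) = 0 := h3 h2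
  exact (congrArg (ρ.map n) (polylinearPart_coe (p : polylinear k Ω n))).symm.trans h4

end FaithfulAlgebra

end DiOperad

namespace DiOperad

/-! ### Surjectivity of `ζ`, and polylinear identities as kernels. -/

section Identities

variable {k : Type u} [Field k] {Ω : Language.{u}} {X : Type}

theorem Term.exists_forget (t : Term Ω X) : ∃ t' : Term Ω.two X, t'.forget = t := by
  induction t with
  | var x => exact ⟨.var x, rfl⟩
  | op s a ih =>
    choose b hb using ih
    exact ⟨.op ⟨s, ⟨0, by have := Ω.two_le s; omega⟩⟩ b, congrArg (Term.op s) (funext hb)⟩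

/-- Let the superscripts point along the path from the root to some occurrence of `x`; superscripts
off this path are arbitrary. -/
theorem Term.exists_forget_head (t : Term Ω X) (x : X) (hx : t.deg x ≠ 0) :
    ∃ t' : Term Ω.two X, t'.forget = t ∧ t'.head = x := by
  classical
  induction t with
  | var y =>
    refine ⟨.var y, rfl, ?_⟩
    by_contra h
    exact hx (Finsupp.single_eq_of_ne (Ne.symm h))
  | op s a ih =>
    simp only [Term.deg, Finsupp.finsetSum_apply] at hx
    obtain ⟨j, -, hj⟩ := Finset.exists_ne_zero_of_sum_ne_zero hx
    obtain ⟨t', h1, h2⟩ := ih j hj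
    choose b hb using fun i => (a i).exists_forget
    have hu : ∀ i, (Function.update b j t' i).forget = a i := by
      intro i
      by_cases h : i = j
      · rw [h, Function.update_self, h1]
      · rw [Function.update_of_ne h, hb]
    refine ⟨.op ⟨s, j⟩ (Function.update b j t'), congrArg (Term.op s) (funext hu), ?_⟩
    exact (congrArg Term.head (Function.update_self (β := fun _ => Term Ω.two X) _ _ _)).trans h2

/-- In a polylinear term every variable occurs, so for each `i` the term lifts to one with
emphasized variable `x_i`. Lifting the coefficient of `e_i` in this way for every `i` and adding up
gives a preimage. -/
theorem zeta_isQuotient : (zeta k Ω).IsQuotient := by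
  classical
  intro n x
  -- The choice is made for all terms in order to get a total function; when `x_i` does not occur,
  -- the value is irrelevant.
  have hex : ∀ (i : Fin n) (t : Term Ω (Fin n)), ∃ t' : Term Ω.two (Fin n), t.deg i ≠ 0 →
      t'.forget = t ∧ t'.head = i := fun i t => by
    by_cases h : t.deg i = 0
    · exact ⟨t.exists_forget.choose, fun h' => absurd h h'⟩
    · exact (t.exists_forget_head i h).imp fun _ ht _ => ht
  choose T hT using hex
  let c : Fin n → polylinear k Ω n := fun i => diCoord (freeOperad k Ω) i x
  have hdeg : ∀ i, ∀ t ∈ (c i : Poly k Ω (Fin n)).support, ∀ j, t.deg j ≠ 0 := fun i t ht j => by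
    rw [mem_polylinear_deg (c i).2 ht j]
    exact one_ne_zero
  let y : Fin n → polylinear k Ω.two n := fun i =>
    ⟨(c i : Poly k Ω (Fin n)).mapDomain (T i), by
      refine (Finsupp.mem_supported k _).mpr fun t' ht' => ?_
      obtain ⟨t, ht, rfl⟩ := Finset.mem_image.mp (Finsupp.mapDomain_support ht')
      show (T i t).deg = _
      rw [← Term.deg_forget, (hT i t (hdeg i t ht i)).1]
      exact (Finsupp.mem_supported k _).mp (c i).2 ht⟩
  have hy : ∀ i j, zetaComponent k Ω j (y i) = if i = j then c j else 0 := by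
    intro i j
    refine Subtype.ext ?_
    rw [zetaComponent_coe]
    show Poly.component j (Finsupp.mapDomain (T i) (c i : Poly k Ω (Fin n))) = _
    rw [Finsupp.mapDomain, Finsupp.sum, map_sum]
    split_ifs with h
    · subst h
      conv_rhs => rw [← Finsupp.sum_single (c i : Poly k Ω (Fin n))]
      refine Finset.sum_congr rfl fun t ht => ?_
      rw [Poly.component_single _ _ (hT i t (hdeg i t ht i)).2, (hT i t (hdeg i t ht i)).1]
    · refine Finset.sum_eq_zero fun t ht => ?_
      refine Poly.component_single_of_ne _ _ ?_ _
      rwa [(hT i t (hdeg i t ht i)).2]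
  refine ⟨(∑ i, y i : polylinear k Ω.two n), diCoord_ext _ fun j => ?_⟩
  refine (diCoord_zetaMap k Ω j _).trans ?_
  rw [map_sum]
  simp only [hy]
  exact (Finset.sum_ite_eq' Finset.univ j fun _ => c j).trans (if_pos (Finset.mem_univ j))

theorem piTwo_isQuotient {P : Operad.{u} k} {π : Hom (freeOperad k Ω) P} (hπ : π.IsQuotient) :
    (piTwo π).IsQuotient := fun n =>
  (LinearMap.rTensor_surjective _ (hπ n)).comp (zeta_isQuotient n)

variable {P R : Operad.{u} k}

theorem diCoord_piTwo (π : Hom (freeOperad k Ω) P) {n : ℕ} (p : polylinear k Ω.two n)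
    (i : Fin n) : diCoord P i ((piTwo π).map n p) = π.map n (zetaComponent k Ω i p) :=
  (diCoord_diMapAux π i _).trans (congrArg (π.map n) (diCoord_zetaMap k Ω i p))

/-- A special structure morphism is by definition some `β` composed with `ω`, so quantifying over
special algebras is quantifying over all `β`. Speciality disappears from the rest of the argument.
-/
theorem isSpecialIdentity_iff (π : Hom (freeOperad k Ω) P) (ω : Hom P R) (f : Poly k Ω X) :
    IsSpecialIdentity π ω f ↔ IsIdentity (ω.comp π) f :=
  ⟨fun h A _ _ β => h A (β.comp ω) ⟨β, rfl⟩, by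
    rintro h A _ _ _ ⟨β, rfl⟩
    exact h A β⟩

theorem isIdentity_of_map_eq_zero (φ : Hom (freeOperad k Ω) P) {n : ℕ} (p : polylinear k Ω n)
    (hp : φ.map n p = 0) : IsIdentity φ (p : Poly k Ω (Fin n)) := fun A _ _ α v => by
  rw [Hom.eval_algStructure]
  have h : (α.comp φ).map n p = 0 := (congrArg (α.map n) hp).trans (map_zero _)
  rw [h]
  rfl

/-- If the target of a morphism from a free operad is a quotient of some free operad, the
polylinear identities are exactly the elements of the kernel. -/
theorem isIdentity_iff_map_eq_zero (φ : Hom (freeOperad k Ω) P) {Ξ : Language.{u}}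
    (ρ : Hom (freeOperad k Ξ) P) (hρ : ρ.IsQuotient) {n : ℕ} (p : polylinear k Ω n) :
    IsIdentity φ (p : Poly k Ω (Fin n)) ↔ φ.map n p = 0 := by
  refine ⟨fun h => ?_, isIdentity_of_map_eq_zero φ p⟩
  -- The algebra is built from `ρ`, not from `φ`, which need not be surjective; this matters for
  -- special identities, where `φ` passes through `ω`.
  obtain ⟨A, _, _, β, hβ⟩ := exists_faithful_algebra ρ hρ n
  refine hβ _ (MultilinearMap.ext fun v => ?_)
  have h1 := h A β v
  rwa [Hom.eval_algStructure] at h1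

theorem isIdentity_piTwo_iff (π : Hom (freeOperad k Ω) P) (hπ : π.IsQuotient) {n : ℕ}
    (p : polylinear k Ω.two n) :
    IsIdentity (piTwo π) (p : Poly k Ω.two (Fin n)) ↔
      ∀ i, IsIdentity π (zetaComponent k Ω i p : Poly k Ω (Fin n)) := by
  rw [isIdentity_iff_map_eq_zero _ _ (piTwo_isQuotient hπ)]
  simp only [isIdentity_iff_map_eq_zero _ _ hπ, ← diCoord_piTwo]
  refine ⟨fun h i => ?_, fun h => diCoord_ext P fun i => (h i).trans (map_zero _).symm⟩
  rw [h, map_zero]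

/-- Both sides become the vanishing of an image, in `diR` and in `R` respectively. The quotient
morphism onto `diR` required for this is `piTwo ρ`, and `ω ⊗ id` acts on each coordinate by `ω`. -/
theorem isSpecialIdentity_piTwo_iff {Ξ : Language.{u}} (π : Hom (freeOperad k Ω) P)
    (ρ : Hom (freeOperad k Ξ) R) (hρ : ρ.IsQuotient) (ω : Hom P R) {n : ℕ}
    (p : polylinear k Ω.two n) :
    IsSpecialIdentity (piTwo π) (diMap ω) (p : Poly k Ω.two (Fin n)) ↔
      ∀ i, IsSpecialIdentity π ω (zetaComponent k Ω i p : Poly k Ω (Fin n)) := by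
  simp only [isSpecialIdentity_iff]
  rw [isIdentity_iff_map_eq_zero _ _ (piTwo_isQuotient hρ)]
  simp only [isIdentity_iff_map_eq_zero _ _ hρ]
  have hc : ∀ i, diCoord R i (((diMap ω).comp (piTwo π)).map n p) =
      (ω.comp π).map n (zetaComponent k Ω i p) := fun i =>
    (diCoord_diMapAux ω i _).trans (congrArg (ω.map n) (diCoord_piTwo π p i))
  simp only [← hc]
  refine ⟨fun h i => ?_, fun h => diCoord_ext R fun i => (h i).trans (map_zero _).symm⟩
  rw [h, map_zero]

theorem diCoord_sum_tmul {n : ℕ} (g : Fin n → P.obj n) (i : Fin n) :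
    diCoord P i (∑ i, diTmul P (g i) (permBasis i)) = g i := by
  rw [map_sum, Finset.sum_eq_single i]
  · rw [diCoord_tmul, permCoord_basis, if_pos rfl, one_smul]
  · intro j _ hj
    rw [diCoord_tmul, permCoord_basis, if_neg (Ne.symm hj), zero_smul]
  · simp

/-- The coefficients with respect to the basis `e_i` are unique, so the family quantified
existentially in (S2) has only one candidate. -/
theorem zeta_eq_sum_iff {n : ℕ} (p : polylinear k Ω.two n) (g : Fin n → polylinear k Ω n) :
    (zeta k Ω).map n p = ∑ i, diTmul (freeOperad k Ω) (g i) (permBasis i) ↔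
      ∀ i, g i = zetaComponent k Ω i p := by
  have hc := diCoord_sum_tmul (P := freeOperad k Ω) g
  constructor
  · intro h i
    refine (hc i).symm.trans ?_
    rw [← h]
    exact diCoord_zetaMap k Ω i p
  · intro h
    refine diCoord_ext _ fun i => ?_
    exact (diCoord_zetaMap k Ω i p).trans ((h i).symm.trans (hc i).symm)

end Identities

end DiOperad

namespace DiOperad

/-! ### Complete linearization in characteristic 0. -/

section Linearization

variable {k : Type u} [Field k] {Ω : Language.{u}} {X : Type} {A : Type u} [AddCommGroup A]
  [Module k A]

theorem Term.eval_smul (ops : AlgStructure k Ω A) (c : X → k) (v : X → A) (t : Term Ω X) :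
    t.eval ops (fun x => c x • v x) = (t.deg.prod fun x n => c x ^ n) • t.eval ops v := by
  induction t with
  | var x => simp [Term.eval, Term.deg]
  | op s a ih =>
    simp only [Term.eval, Term.deg, ih]
    rw [MultilinearMap.map_smul_univ]
    refine congrArg (· • _) ?_
    exact Finsupp.prod_finsetSum_index (M := ℕ) (N := k) (h := fun x n => c x ^ n)
      (fun x => pow_zero _) (fun x m n => pow_add _ _ _)

/-- The generating function `c ↦ ℓ (f(c₁ v₁, c₂ v₂, …))`, as a polynomial in the scalars `c`. -/
noncomputable def scaledValue (ops : AlgStructure k Ω A) (l : A →ₗ[k] k) (v : X → A) :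
    Poly k Ω X →ₗ[k] MvPolynomial X k :=
  Finsupp.linearCombination k fun t => MvPolynomial.monomial t.deg (l (t.eval ops v))

theorem eval_scaledValue (ops : AlgStructure k Ω A) (l : A →ₗ[k] k) (v : X → A) (c : X → k)
    (f : Poly k Ω X) :
    MvPolynomial.eval c (scaledValue ops l v f) = l (Poly.eval ops (fun x => c x • v x) f) := by
  induction f using Finsupp.induction_linear with
  | zero => simp
  | add f f' h h' => simp only [map_add, h, h']
  | single t a =>
    simp [scaledValue, Poly.eval_single, Term.eval_smul, MvPolynomial.smul_eval,
      MvPolynomial.eval_monomial, mul_comm]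

open Classical in
/-- The homogeneous part of multidegree `d` of a polynomial. -/
noncomputable def homogeneousPart (d : X →₀ ℕ) (f : Poly k Ω X) : Poly k Ω X :=
  f.filter fun t => t.deg = d

theorem homogeneousPart_of_mem {d : X →₀ ℕ} {f : Poly k Ω X} (hf : f ∈ Poly.homogeneous k Ω d) :
    homogeneousPart d f = f := by
  classical
  exact (Finsupp.filter_eq_self_iff (fun t : Term Ω X => t.deg = d) f).mpr fun t ht =>
    (Finsupp.mem_supported k _).mp hf (Finsupp.mem_support_iff.mpr ht)

theorem linearize_coe (d : ℕ →₀ ℕ) (f : Poly k Ω ℕ) :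
    (linearize d f : Poly k Ω (Fin d.degree)) = homogeneousPart (ones d.degree)
      (Poly.subst (fun i => ∑ j with block d j = i, Poly.var j) f) := by
  unfold linearize homogeneousPart
  congr!

/-- This lets homogeneous parts of `f` be isolated through coefficients of ordinary commutative
polynomials. -/
theorem coeff_scaledValue (ops : AlgStructure k Ω A) (l : A →ₗ[k] k) (v : X → A) (d : X →₀ ℕ)
    (f : Poly k Ω X) :
    (scaledValue ops l v f).coeff d = l (Poly.eval ops v (homogeneousPart d f)) := by
  classical
  unfold homogeneousPart
  induction f using Finsupp.induction_linear with
  | zero => rw [Finsupp.filter_zero]; simp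
  | add f f' h h' => simp only [map_add, MvPolynomial.coeff_add, Finsupp.filter_add, h, h']
  | single t a =>
    by_cases ht : t.deg = d
    · rw [Finsupp.filter_single_of_pos (fun t : Term Ω X => t.deg = d) ht]
      simp [scaledValue, Poly.eval_single, MvPolynomial.coeff_monomial, ht]
    · rw [Finsupp.filter_single_of_neg (fun t : Term Ω X => t.deg = d) ht]
      simp [scaledValue, MvPolynomial.coeff_monomial, ht]

/-- The value `i` is taken by `block d` exactly `d i` times, being its multiplicity in the sorted
multiset. -/
theorem sum_single_block (d : ℕ →₀ ℕ) : ∑ j, Finsupp.single (block d j) 1 = d := by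
  have h1 : ∀ d : ℕ →₀ ℕ, (d.toMultiset.map fun i => Finsupp.single i 1).sum = d := by
    intro d
    induction d using Finsupp.induction_linear with
    | zero => simp
    | add d d' h h' => simp only [map_add, Multiset.map_add, Multiset.sum_add, h, h']
    | single i n => simp [Multiset.map_nsmul, Multiset.sum_nsmul]
  conv_rhs => rw [← h1 d, ← Multiset.sort_eq d.toMultiset (· ≤ ·), Multiset.map_coe,
    Multiset.sum_coe, ← Fin.sum_univ_fun_getElem]
  exact Equiv.sum_comp (finCongr (length_sort_toMultiset d).symm) fun j =>
    Finsupp.single ((d.toMultiset.sort (· ≤ ·)).get j) 1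

/-- Up to a nonzero factor, the coefficient at the linear monomial after substituting for every
`X_i` the sum of the variables of its block is the coefficient at `d`. -/
theorem exists_coeff_bind_block [CharZero k] (d : ℕ →₀ ℕ) : ∃ C : k, C ≠ 0 ∧
    ∀ q : MvPolynomial ℕ k, (MvPolynomial.bind₁
      (fun i => ∑ j with block d j = i, (MvPolynomial.X j : MvPolynomial (Fin d.degree) k))
        q).coeff (ones d.degree) = C * q.coeff d := by
  classical
  -- Expanding the product of block sums for the monomial of degree `d'` means choosing, for each
  -- factor, a new variable from its block. `S d'` collects the choices that use every new variable
  -- exactly once, so its size is the coefficient sought.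
  let S : (d' : ℕ →₀ ℕ) → Finset (Fin d'.degree → Fin d.degree) := fun d' =>
    (Fintype.piFinset fun j => Finset.univ.filter fun i => block d i = block d' j).filter
      fun p => ∑ j, Finsupp.single (p j) 1 = ones d.degree
  have hS : ∀ d' (p : Fin d'.degree → Fin d.degree), p ∈ S d' ↔
      (∀ j, block d (p j) = block d' j) ∧ ∑ j, Finsupp.single (p j) 1 = ones d.degree := by
    simp [S]
  have hones : ∑ j : Fin d.degree, Finsupp.single j 1 = ones d.degree := by
    ext q
    simp [ones, Finsupp.finsetSum_apply, Finsupp.single_apply]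
  -- Such a choice is a bijection preserving blocks, so the two multidegrees coincide.
  have hne : ∀ d', d' ≠ d → S d' = ∅ := by
    intro d' hd
    refine Finset.eq_empty_of_forall_notMem fun p hp => hd ?_
    obtain ⟨h1, h2⟩ := (hS _ _).mp hp
    rw [← sum_single_block d', ← sum_single_block d]
    simp only [← h1]
    exact Function.Bijective.sum_comp (bijective_of_sum_single p h2)
      fun j => Finsupp.single (block d j) 1
  have hmem : id ∈ S d := (hS _ _).mpr ⟨fun _ => rfl, hones⟩
  -- The number of block-preserving permutations, that is `∏ d_i!`; it is positive because the
  -- identity is one of them, and nonzero in `k` by characteristic 0.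
  refine ⟨(S d).card, Nat.cast_ne_zero.mpr (Finset.card_ne_zero_of_mem hmem), fun q => ?_⟩
  have hmon : ∀ d', (d'.prod fun i n => (∑ j with block d j = i,
      (MvPolynomial.X j : MvPolynomial (Fin d.degree) k)) ^ n).coeff (ones d.degree) =
        (S d').card := by
    intro d'
    conv_lhs => rw [← sum_single_block d']
    rw [← Finsupp.prod_finsetSum_index (fun _ => pow_zero _) (fun _ _ _ => pow_add _ _ _)]
    simp only [Finsupp.prod_single_index, pow_zero, pow_one]
    rw [Finset.prod_univ_sum, MvPolynomial.coeff_sum]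
    have hX : ∀ p : Fin d'.degree → Fin d.degree,
        (∏ j, (MvPolynomial.X (p j) : MvPolynomial (Fin d.degree) k)) =
          MvPolynomial.monomial (∑ j, Finsupp.single (p j) 1) 1 := by
      intro p
      rw [MvPolynomial.monomial_sum_one]
      rfl
    simp only [hX, MvPolynomial.coeff_monomial]
    rw [Finset.sum_boole]
  induction q using MvPolynomial.induction_on' with
  | monomial d' a =>
    rw [MvPolynomial.bind₁_monomial, MvPolynomial.coeff_C_mul, MvPolynomial.coeff_monomial]
    refine (congrArg (a * ·) (hmon d')).trans ?_
    by_cases hd : d' = d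
    · subst hd
      simp [mul_comm]
    · simp [hne d' hd, hd]
  | add p q hp hq => simp only [map_add, MvPolynomial.coeff_add, hp, hq, mul_add]

variable [CharZero k]

/-- The scaled value of the substituted polynomial vanishes for every choice of scalars, hence is
the zero polynomial, as `k` is infinite; its coefficient at `(1, …, 1)` is the functional applied to
the linearization. Functionals separate the points of `A`. -/
theorem eval_linearize (ops : AlgStructure k Ω A) (f : Poly k Ω ℕ)
    (hf : ∀ v : ℕ → A, Poly.eval ops v f = 0) (d : ℕ →₀ ℕ) (w : Fin d.degree → A) :
    Poly.eval ops w (linearize d f : Poly k Ω (Fin d.degree)) = 0 := by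
  refine (Module.forall_dual_apply_eq_zero_iff k _).mp fun l => ?_
  rw [linearize_coe, ← coeff_scaledValue]
  refine (congrArg (MvPolynomial.coeff _) (MvPolynomial.funext fun c => ?_)).trans
    (MvPolynomial.coeff_zero _)
  rw [eval_scaledValue, Poly.eval_subst, hf, map_zero, map_zero]

/-- Evaluate the linearization with equal arguments inside each block: this recovers the homogeneous
part up to the factor from `exists_coeff_bind_block`. -/
theorem eval_homogeneousPart_of_eval_linearize (ops : AlgStructure k Ω A) (f : Poly k Ω ℕ)
    (d : ℕ →₀ ℕ) (hf : ∀ w : Fin d.degree → A,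
      Poly.eval ops w (linearize d f : Poly k Ω (Fin d.degree)) = 0) (v : ℕ → A) :
    Poly.eval ops v (homogeneousPart d f) = 0 := by
  refine (Module.forall_dual_apply_eq_zero_iff k _).mp fun l => ?_
  rw [← coeff_scaledValue]
  obtain ⟨C, hC, hb⟩ := exists_coeff_bind_block (k := k) d
  refine (mul_eq_zero.mp ((hb _).symm.trans ?_)).resolve_left hC
  have h1 := hf fun j => v (block d j)
  rw [linearize_coe] at h1
  refine Eq.trans ?_ ((coeff_scaledValue ops l _ _ _).trans ((congrArg l h1).trans (map_zero l)))
  -- Both generating polynomials agree at every point `c`: replacing each scalar of `x_i` by the sum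
  -- over its block is the same as substituting the sum of the block with every new variable equal
  -- to a multiple of `v i`.
  refine congrArg (MvPolynomial.coeff _) (MvPolynomial.funext fun c => ?_)
  rw [eval_scaledValue, Poly.eval_subst]
  refine (MvPolynomial.eval₂Hom_bind₁ (RingHom.id k) c _ _).trans ?_
  refine (eval_scaledValue ops l v _ f).trans ?_
  simp only [map_sum, Poly.eval_var, MvPolynomial.eval₂Hom_X', Finset.sum_smul]
  congr 3
  funext i
  refine Finset.sum_congr rfl fun j hj => ?_
  rw [(Finset.mem_filter.mp hj).2]

theorem eval_eq_zero_of_eval_linearize (ops : AlgStructure k Ω A) (f : Poly k Ω ℕ)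
    (hf : ∀ (d : ℕ →₀ ℕ) (w : Fin d.degree → A),
      Poly.eval ops w (linearize d f : Poly k Ω (Fin d.degree)) = 0) (v : ℕ → A) :
    Poly.eval ops v f = 0 := by
  refine (Module.forall_dual_apply_eq_zero_iff k _).mp fun l => ?_
  have h : scaledValue ops l v f = 0 := by
    ext d
    rw [coeff_scaledValue, eval_homogeneousPart_of_eval_linearize ops f d (hf d), map_zero,
      MvPolynomial.coeff_zero]
  -- Setting all scalars to `1` recovers the value of `f` itself.
  have h1 := eval_scaledValue ops l v (fun _ => 1) f
  simpa [h] using h1.symm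

variable {P : Operad.{u} k} (φ : Hom (freeOperad k Ω) P)

theorem isIdentity_iff_linearize (f : Poly k Ω ℕ) :
    IsIdentity φ f ↔
      ∀ d : ℕ →₀ ℕ, IsIdentity φ (linearize d f : Poly k Ω (Fin d.degree)) :=
  ⟨fun h d A _ _ α w => eval_linearize _ f (h A α) d w,
    fun h A _ _ α v => eval_eq_zero_of_eval_linearize _ f (fun d => h d A α) v⟩

theorem isIdentity_iff_linearize_of_homogeneous {d : ℕ →₀ ℕ} (f : Poly k Ω ℕ)
    (hf : f ∈ Poly.homogeneous k Ω d) :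
    IsIdentity φ f ↔ IsIdentity φ (linearize d f : Poly k Ω (Fin d.degree)) := by
  refine ⟨fun h A _ _ α w => eval_linearize _ f (h A α) d w, fun h A _ _ α v => ?_⟩
  have h1 := eval_homogeneousPart_of_eval_linearize _ f d (h A α) v
  rwa [homogeneousPart_of_mem hf] at h1

end Linearization

end DiOperad
-- Assembly of the two equivalences.
theorem mainTheorem4 {k : Type u} [Field k] [CharZero k] {Ω Ξ : DiOperad.Language.{u}}
    {P R : Operad.{u} k}
    (π : Hom (freeOperad k Ω) P) (hπ : π.IsQuotient)
    (ρ : Hom (freeOperad k Ξ) R) (hρ : ρ.IsQuotient)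
    (ω : Hom (freeOperad k Ω) (freeOperad k Ξ)) (ω' : Hom P R)
    (hω : ω'.comp π = ρ.comp ω)
    (f : Poly k Ω.two ℕ) :
    (∀ d : ℕ →₀ ℕ, f ∈ Poly.homogeneous k Ω.two d →
      ((IsSpecialIdentity (piTwo π) (diMap ω') f ∧ ¬ IsIdentity (piTwo π) f) ↔
        ∃ g : Fin d.degree → polylinear k Ω d.degree,
          (zeta k Ω).map d.degree (linearize d f) =
              ∑ i, diTmul (freeOperad k Ω) (g i) (permBasis i) ∧
            (∀ i, IsSpecialIdentity π ω' (g i : Poly k Ω (Fin d.degree))) ∧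
            ∃ i, ¬ IsIdentity π (g i : Poly k Ω (Fin d.degree)))) ∧
    ((IsSpecialIdentity (piTwo π) (diMap ω') f ∧ ¬ IsIdentity (piTwo π) f) ↔
      ∃ g : (d : ℕ →₀ ℕ) → Fin d.degree → polylinear k Ω d.degree,
        (∀ d : ℕ →₀ ℕ, (zeta k Ω).map d.degree (linearize d f) =
            ∑ i, diTmul (freeOperad k Ω) (g d i) (permBasis i)) ∧
          (∀ (d : ℕ →₀ ℕ) (i : Fin d.degree), IsSpecialIdentity π ω' (g d i : Poly k Ω (Fin d.degree))) ∧
          ∃ (d : ℕ →₀ ℕ) (i : Fin d.degree), ¬ IsIdentity π (g d i : Poly k Ω (Fin d.degree))) := by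
  have hs : ∀ d : ℕ →₀ ℕ, (IsSpecialIdentity (piTwo π) (diMap ω')
      (linearize d f : Poly k Ω.two (Fin d.degree)) ↔ ∀ i, IsSpecialIdentity π ω'
        (zetaComponent k Ω i (linearize d f) : Poly k Ω (Fin d.degree))) := fun d =>
    isSpecialIdentity_piTwo_iff π ρ hρ ω' _
  have hi : ∀ d : ℕ →₀ ℕ, (IsIdentity (piTwo π) (linearize d f : Poly k Ω.two (Fin d.degree)) ↔
      ∀ i, IsIdentity π (zetaComponent k Ω i (linearize d f) : Poly k Ω (Fin d.degree))) :=
    fun d => isIdentity_piTwo_iff π hπ _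
  refine ⟨fun d hf => ?_, ?_⟩
  -- Speciality is absorbed into the morphism so that the linearization criterion applies, and is
  -- then restored in order to pass to components.
  · rw [isSpecialIdentity_iff, isIdentity_iff_linearize_of_homogeneous _ f hf,
      ← isSpecialIdentity_iff, hs, isIdentity_iff_linearize_of_homogeneous _ f hf, hi, not_forall]
    constructor
    · rintro ⟨h1, h2⟩
      exact ⟨fun i => zetaComponent k Ω i (linearize d f),
        (zeta_eq_sum_iff _ _).mpr fun _ => rfl, h1, h2⟩
    · rintro ⟨g, hg, h1, h2⟩
      -- The given family is forced to be that of the components of `ζ`.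
      obtain rfl := funext ((zeta_eq_sum_iff _ _).mp hg)
      exact ⟨h1, h2⟩
  · rw [isSpecialIdentity_iff, isIdentity_iff_linearize, isIdentity_iff_linearize]
    simp only [← isSpecialIdentity_iff, hs, hi, not_forall]
    constructor
    · rintro ⟨h1, h2⟩
      exact ⟨fun d i => zetaComponent k Ω i (linearize d f),
        fun d => (zeta_eq_sum_iff _ _).mpr fun _ => rfl, h1, h2⟩
    · rintro ⟨g, hg, h1, h2⟩
      obtain rfl := funext fun d => funext ((zeta_eq_sum_iff _ _).mp (hg d))
      exact ⟨h1, h2⟩
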